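/- Let $p_0,p_1,p_2,\dots\in(0,1)$ and put $q_j=1-p_j$, $r_j=p_j/q_j$. \emph{Inhomogeneous oriented digital boiling (ODB)} with site probabilities $(p_x)$ is the random evolution of heights $h_t(x)\in\mathbf Z_{\ge 0}\cup\{-\infty\}$ ($t,x=0,1,2,\dots$) started from $h_0(0)=0$ and $h_0(x)=-\infty$ for $x\ge 1$, with the following rules (where $h_t(-1)=-\infty$): if $h_t(x-1)>h_t(x)$, then $h_{t+1}(x)=h_t(x-1)$; otherwise, independently of the other sites and other times, $h_{t+1}(x)=h_t(x)+1$ with probability $p_x$ and $h_{t+1}(x)=h_t(x)$ with probability $q_x$. (The random choices are given by independent coins, one for each site $x$ and time $t$, with success probability $p_x$.) For a partition $\lambda$ let $\ell(\lambda)$ be its number of parts, $\lambda'$ its conjugate, $d_\lambda(M)$ the number of semistandard Young tableaux of shape $\lambda$ with entries in $\{1,\dots,M\}$, and $s_\lambda$ the Schur function. Let $0\le x\le t$ and $h\ge 0$ be integers and put $m=t-x$. Then $$\mathrm{Prob}\bigl(h_t(x)\le h\bigr)=q_0^m\cdots q_x^m\sum_{\lambda:\ \ell(\lambda)\le h} d_\lambda(m)\,s_{\lambda'}(r_0,\dots,r_x),$$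 where the sum over all partitions $\lambda$ (including the empty one) with $\ell(\lambda)\le h$ converges. Moreover $$\mathrm{Prob}\bigl(h_t(x)\le h\bigr)=q_0^m\cdots q_x^m\,\det\bigl(\varphi_{i-j}\bigr)_{0\le i,j\le h-1},\qquad \varphi(z)=(1-1/z)^{-m}\prod_{j=0}^{x}(1+r_jz),$$ where $\varphi_k=\frac1{2\pi i}\oint_{|z|=R}\varphi(z)z^{-k-1}\,dz$ for any radius $R>1$ (the determinant is $1$ for $h=0$). In particular, $\mathrm{Prob}(h_t(x)\le h)$ depends only on $p_0,\dots,p_x$ among the site probabilities and is a symmetric function of $(p_0,\dots,p_x)$. -/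

import Mathlib

/-! ### Inhomogeneous oriented digital boiling -/

/-- The height of the left neighbour `x - 1` of the site `x`, with the convention `h(-1) = -∞`. -/
def leftHeight (η : ℕ → WithBot ℕ) : ℕ → WithBot ℕ
  | 0 => ⊥
  | x + 1 => η x

/-- Corner initialization: height `0` at the site `0` and `-∞` at every other site. -/
def cornerHeight (x : ℕ) : WithBot ℕ := if x = 0 then 0 else ⊥

/-- `η t x` (the height of the site `x` at time `t`) evolves from corner initialization by the
rules of oriented digital boiling, where the coin `ξ x t` decides whether the height of the site
`x` increases spontaneously between the times `t` and `t + 1` (if the left neighbour is not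
strictly higher). -/
structure IsODBTrajectory (ξ : ℕ → ℕ → Bool) (η : ℕ → ℕ → WithBot ℕ) : Prop where
  init : ∀ x, η 0 x = cornerHeight x
  catch_up : ∀ t x, η t x < leftHeight (η t) x → η (t + 1) x = leftHeight (η t) x
  grow : ∀ t x, ¬ η t x < leftHeight (η t) x → ξ x t = true → η (t + 1) x = η t x + 1
  rest : ∀ t x, ¬ η t x < leftHeight (η t) x → ξ x t = false → η (t + 1) x = η t x

/-- The random heights `H t x` on the probability space `(Ω, μ)` form an inhomogeneous ODB process
with site probabilities `p x`: they almost surely follow the ODB rules driven by coins that are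
independent over all sites and times, the coins of the site `x` showing `true` with probability
`p x`. -/
def IsInhomogeneousODB {Ω : Type*} [MeasurableSpace Ω] (p : ℕ → ℝ) (μ : MeasureTheory.Measure Ω)
    (H : ℕ → ℕ → Ω → WithBot ℕ) : Prop :=
  ∃ ξ : ℕ × ℕ → Ω → Bool,
    (∀ s, Measurable (ξ s)) ∧
    ProbabilityTheory.iIndepFun ξ μ ∧
    (∀ x t, μ.real {ω | ξ (x, t) ω = true} = p x) ∧
    ∀ᵐ ω ∂μ, IsODBTrajectory (fun x t => ξ (x, t) ω) (fun t x => H t x ω)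

/-! ### Semistandard Young tableaux with bounded entries and Schur functions -/

/-- Semistandard Young tableaux of shape `lam` with entries from an alphabet of `M` letters
(the letters are `0, …, M - 1`). -/
def BoundedSSYT (lam : YoungDiagram) (M : ℕ) : Type :=
  {T : SemistandardYoungTableau lam // ∀ c ∈ lam.cells, T c.1 c.2 < M}

instance BoundedSSYT.instFinite (lam : YoungDiagram) (M : ℕ) : Finite (BoundedSSYT lam M) := by
  refine Finite.of_injective
    (fun (T : BoundedSSYT lam M) (c : lam.cells) => (⟨T.1 c.1.1 c.1.2, T.2 c.1 c.2⟩ : Fin M)) ?_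
  intro T T' h
  refine Subtype.ext (SemistandardYoungTableau.ext fun i j => ?_)
  by_cases hc : (i, j) ∈ lam
  · have := congrFun h ⟨(i, j), hc⟩
    simpa using this
  · rw [T.1.zeros hc, T'.1.zeros hc]

noncomputable instance BoundedSSYT.instFintype (lam : YoungDiagram) (M : ℕ) :
    Fintype (BoundedSSYT lam M) :=
  Fintype.ofFinite _

/-- The entry of a bounded tableau in a cell of its shape, as a letter of the alphabet. -/
def BoundedSSYT.letter {lam : YoungDiagram} {M : ℕ} (T : BoundedSSYT lam M) (c : lam.cells) :
    Fin M :=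
  ⟨T.1 c.1.1 c.1.2, T.2 c.1 c.2⟩

/-- `d_lam(M)`: the number of semistandard Young tableaux of shape `lam` with entries from an
alphabet of `M` letters. -/
noncomputable def ssytCount (lam : YoungDiagram) (M : ℕ) : ℕ := Fintype.card (BoundedSSYT lam M)

/-- The Schur function `s_lam(r_0, …, r_{n-1}, 0, 0, …)`, as the generating function of
semistandard Young tableaux by content. -/
noncomputable def schurValue (lam : YoungDiagram) {n : ℕ} (r : Fin n → ℝ) : ℝ :=
  ∑ T : BoundedSSYT lam n, ∏ c : lam.cells, r (T.letter c)

/-- `ℓ(lam)`: the number of rows (non-zero parts) of a partition. -/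
def partitionLength (lam : YoungDiagram) : ℕ := lam.rowLens.length

/-! ### Toeplitz determinants -/

/-- The `k`-th Fourier (Laurent) coefficient of `φ` on the circle `|z| = R`:
`(2πi)⁻¹ ∮_{|z| = R} φ(z) z^{-k-1} dz`. -/
noncomputable def laurentCoeff (φ : ℂ → ℂ) (R : ℝ) (k : ℤ) : ℂ :=
  (2 * (Real.pi : ℂ) * Complex.I)⁻¹ * ∮ z in C(0, R), φ z * z ^ (-k - 1)

/-- The `h × h` Toeplitz determinant `det (φ_{i-j})_{0 ≤ i, j < h}` of the symbol `φ`, with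
coefficients computed on the circle `|z| = R`. -/
noncomputable def toeplitzDet (φ : ℂ → ℂ) (R : ℝ) (h : ℕ) : ℂ :=
  (Matrix.of fun i j : Fin h => laurentCoeff φ R ((i : ℤ) - (j : ℤ))).det

/-- The symbol `(1 - 1/z)^{-m} ∏_j (1 + r_j z)`. -/
noncomputable def odbSymbol (m : ℕ) {n : ℕ} (r : Fin n → ℝ) (z : ℂ) : ℂ :=
  (1 - 1 / z) ^ (-(m : ℤ)) * ∏ j, (1 + (r j : ℂ) * z)

/-! The heights are first-row lengths in a growth diagram. The rules of ODB amount to `h_{t+1}(x) =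
max(h_t(x-1), h_t(x) + coin)`. Since site `k` first becomes finite at time `k`, the coins relevant
to `h_{x+m}(x)` form a 0-1 matrix with entries `ξ (k, k + i)`, `k ≤ x`, `i < m`. The local rule of
dual RSK acts on first rows by the same recursion, so the height is the first row of the final shape
`κ` of the growth diagram of this matrix (`eq_growthHeight`, `hasFirstRows_growth`).

A matrix `A` of coins has probability `∏ q_k^m ∏ r_k^{A k i}`. The local rule is a bijection in each
square that preserves the total number of boxes (`dualLocal_injective`, `dualLocal_surjective`,
`card_dualLocal`). Summing square by square gives the final shape the weight `d_{κ'}(m) s_κ(r)`: the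
last column of the diagram is a chain of `m` vertical strips, and successive columns contribute the
horizontal strips of the branching rule (`sum_growth`, `sum_growth_last`). Transposing turns `κ_1 ≤
h` into `ℓ(λ) ≤ h`. Only finitely many terms are non-zero, since `s_{λ'}` in `x + 1` variables
vanishes once `λ` has more than `x + 1` columns.

The determinant comes from Gessel's identity. Multiplying a generating function by `1 + r z` expands
a Jacobi–Trudi determinant over vertical strips, which gives the dual Jacobi–Trudi identity by
induction on the variables; dividing by `1 - 1/z` expands it over horizontal strips, which are the
letters of the tableaux counted by `d_λ(m)`. Starting from the empty shape, `m` divisions yield the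
sum. The contour integrals satisfy the same recursion as the algebraic coefficients and decay at
`+∞`, hence agree with them. Symmetry in the `p_j` is visible in the symbol. -/

namespace YoungDiagram

/-! ### Young diagrams by row lengths; horizontal and vertical strips -/

theorem ext_rowLen {κ ν : YoungDiagram} (h : ∀ i, κ.rowLen i = ν.rowLen i) : κ = ν := by
  refine SetLike.ext fun ⟨i, j⟩ => ?_
  rw [mem_iff_lt_rowLen, mem_iff_lt_rowLen, h]

theorem le_iff_rowLen {κ ν : YoungDiagram} : κ ≤ ν ↔ ∀ i, κ.rowLen i ≤ ν.rowLen i := by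
  constructor
  · intro h i
    by_contra! hlt
    have h1 : (i, ν.rowLen i) ∈ ν := h (mem_iff_lt_rowLen.2 hlt)
    exact lt_irrefl _ (mem_iff_lt_rowLen.1 h1)
  · rintro h ⟨i, j⟩ hc
    exact mem_iff_lt_rowLen.2 ((mem_iff_lt_rowLen.1 hc).trans_le (h i))

theorem rowLen_bot (i : ℕ) : (⊥ : YoungDiagram).rowLen i = 0 := by
  by_contra h
  exact notMem_bot (i, 0) (mem_iff_lt_rowLen.2 (Nat.pos_of_ne_zero h))

theorem rowLen_eq_zero_iff {κ : YoungDiagram} {i : ℕ} : κ.rowLen i = 0 ↔ κ.colLen 0 ≤ i := by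
  have h : 0 < κ.rowLen i ↔ i < κ.colLen 0 :=
    mem_iff_lt_rowLen.symm.trans mem_iff_lt_colLen
  omega

theorem card_eq_sum_rowLen {κ : YoungDiagram} {N : ℕ} (hN : κ.colLen 0 ≤ N) :
    κ.cells.card = ∑ i ∈ Finset.range N, κ.rowLen i := by
  rw [Finset.card_eq_sum_card_fiberwise (f := Prod.fst) (t := Finset.range N)]
  · exact Finset.sum_congr rfl fun i _ => (rowLen_eq_card κ).symm
  · rintro ⟨i, j⟩ hc
    have h1 : (i, 0) ∈ κ := κ.up_left_mem le_rfl (Nat.zero_le j) hc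
    simpa using (mem_iff_lt_colLen.1 h1).trans_le hN

/-- The Young diagram whose row lengths are the values of an antitone function, up to the row
`n`. -/
def ofRowFun (f : ℕ → ℕ) (hf : Antitone f) (n : ℕ) : YoungDiagram where
  cells := (Finset.range n ×ˢ Finset.range (f 0)).filter fun c => c.2 < f c.1
  isLowerSet := by
    rintro ⟨i, j⟩ ⟨i', j'⟩ ⟨hi, hj⟩ hc
    simp only [Finset.coe_filter, Finset.mem_product, Finset.mem_range, Set.mem_ofPred_eq] at *
    have := hf hi
    exact ⟨⟨by omega, by omega⟩, by omega⟩

theorem rowLen_ofRowFun {f : ℕ → ℕ} (hf : Antitone f) {n : ℕ} (hn : f n = 0) (i : ℕ) :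
    (ofRowFun f hf n).rowLen i = f i := by
  have key : ∀ j, j < (ofRowFun f hf n).rowLen i ↔ j < f i := fun j => by
    rw [← mem_iff_lt_rowLen]
    have h0 := hf (Nat.zero_le i)
    have hi : n ≤ i → f i = 0 := fun h => Nat.le_zero.1 (hn ▸ hf h)
    change (i, j) ∈ Finset.filter _ _ ↔ _
    simp only [Finset.mem_filter, Finset.mem_product, Finset.mem_range]
    refine ⟨fun h => h.2, fun h => ⟨⟨?_, by omega⟩, h⟩⟩
    by_contra! hni
    have := hi hni
    omega
  have h1 := key (f i)
  have h2 := key ((ofRowFun f hf n).rowLen i)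
  omega

instance finite_le (κ : YoungDiagram) (P : YoungDiagram → Prop) :
    Finite {lam : YoungDiagram // lam ≤ κ ∧ P lam} := by
  refine Finite.of_injective (β := κ.cells.powerset)
    (fun lam => ⟨lam.1.cells, Finset.mem_powerset.2 lam.2.1⟩) fun a b h => ?_
  exact Subtype.ext (YoungDiagram.ext (congrArg Subtype.val h))

/-- `κ / lam` is a horizontal strip. -/
def HStrip (lam κ : YoungDiagram) : Prop :=
  lam ≤ κ ∧ ∀ i j, (i + 1, j) ∈ κ → (i, j) ∈ lam

/-- `κ / lam` is a vertical strip. -/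
def VStrip (lam κ : YoungDiagram) : Prop :=
  lam ≤ κ ∧ ∀ i j, (i, j + 1) ∈ κ → (i, j) ∈ lam

instance finite_hStrip (κ : YoungDiagram) : Finite {lam : YoungDiagram // HStrip lam κ} :=
  finite_le κ _

instance finite_vStrip (κ : YoungDiagram) : Finite {lam : YoungDiagram // VStrip lam κ} :=
  finite_le κ _

noncomputable instance fintypeHStrip (κ : YoungDiagram) :
    Fintype {lam : YoungDiagram // HStrip lam κ} := Fintype.ofFinite _

noncomputable instance fintypeVStrip (κ : YoungDiagram) :
    Fintype {lam : YoungDiagram // VStrip lam κ} := Fintype.ofFinite _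

theorem hStrip_transpose {lam κ : YoungDiagram} :
    HStrip lam.transpose κ.transpose ↔ VStrip lam κ := by
  simp only [HStrip, VStrip, transpose_le_iff, mem_transpose, Prod.swap_prod_mk]
  exact and_congr_right fun _ => forall_comm

theorem hStrip_iff {lam κ : YoungDiagram} :
    HStrip lam κ ↔ ∀ i, lam.rowLen i ≤ κ.rowLen i ∧ κ.rowLen (i + 1) ≤ lam.rowLen i := by
  rw [HStrip, le_iff_rowLen, forall_and]
  refine and_congr_right fun _ => ⟨fun h i => ?_, fun h i j hc => ?_⟩
  · by_contra! hlt
    exact lt_irrefl _ (mem_iff_lt_rowLen.1 (h i _ (mem_iff_lt_rowLen.2 hlt)))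
  · exact mem_iff_lt_rowLen.2 ((mem_iff_lt_rowLen.1 hc).trans_le (h i))

theorem vStrip_iff {lam κ : YoungDiagram} :
    VStrip lam κ ↔ ∀ i, lam.rowLen i ≤ κ.rowLen i ∧ κ.rowLen i ≤ lam.rowLen i + 1 := by
  rw [VStrip, le_iff_rowLen, forall_and]
  refine and_congr_right fun _ => ⟨fun h i => ?_, fun h i j hc => ?_⟩
  · by_contra! hlt
    have := mem_iff_lt_rowLen.1 (h i _ (mem_iff_lt_rowLen.2 hlt))
    omega
  · have := mem_iff_lt_rowLen.1 hc
    have := h i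
    exact mem_iff_lt_rowLen.2 (by omega)

end YoungDiagram

/-! ### Branching rule for Schur polynomials -/

section Branching

open YoungDiagram

variable {R : Type*} [CommSemiring R]

/-- The Schur polynomial of the shape `κ` in the `n` variables `r 0, …, r (n - 1)`. -/
noncomputable def schurSum (κ : YoungDiagram) (n : ℕ) (r : ℕ → R) : R :=
  ∑ T : BoundedSSYT κ n, ∏ c ∈ κ.cells, r (T.1 c.1 c.2)

theorem schurSum_fin (κ : YoungDiagram) (n : ℕ) (r : ℕ → ℝ) :
    schurValue κ (fun j : Fin n => r j) = schurSum κ n r := by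
  refine Finset.sum_congr rfl fun T _ => ?_
  exact Finset.prod_coe_sort κ.cells fun c => r (T.1 c.1 c.2)

theorem schurSum_one (κ : YoungDiagram) (n : ℕ) :
    schurSum κ n (fun _ => (1 : R)) = (ssytCount κ n : R) := by
  simp [schurSum, ssytCount]

theorem schurSum_zero_of_ne_bot {κ : YoungDiagram} (h : κ ≠ ⊥) (r : ℕ → R) :
    schurSum κ 0 r = 0 := by
  have : IsEmpty (BoundedSSYT κ 0) := by
    refine ⟨fun T => h ?_⟩
    refine SetLike.ext fun c => ⟨fun hc => ?_, fun hc => absurd hc (notMem_bot c)⟩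
    exact absurd (T.2 c hc) (Nat.not_lt_zero _)
  simp [schurSum]

theorem BoundedSSYT.ext {κ : YoungDiagram} {n : ℕ} {T T' : BoundedSSYT κ n}
    (h : ∀ i j, (i, j) ∈ κ → T.1 i j = T'.1 i j) : T = T' := by
  refine Subtype.ext (SemistandardYoungTableau.ext fun i j => ?_)
  by_cases hc : (i, j) ∈ κ
  · exact h i j hc
  · rw [T.1.zeros hc, T'.1.zeros hc]

theorem schurSum_bot (n : ℕ) (r : ℕ → R) : schurSum ⊥ n r = 1 := by
  have : Subsingleton (BoundedSSYT ⊥ n) :=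
    ⟨fun T T' => BoundedSSYT.ext fun i j hc => absurd hc (notMem_bot _)⟩
  let T : BoundedSSYT ⊥ n :=
    ⟨SemistandardYoungTableau.highestWeight ⊥, fun c hc => absurd hc (notMem_bot c)⟩
  rw [schurSum, Fintype.sum_subsingleton _ T]
  simp

theorem schurSum_zero (κ : YoungDiagram) (r : ℕ → R) [Decidable (κ = ⊥)] :
    schurSum κ 0 r = if κ = ⊥ then 1 else 0 := by
  split_ifs with h
  · rw [h, schurSum_bot]
  · exact schurSum_zero_of_ne_bot h r

/-- Fill the horizontal strip `κ / lam` with the letter `n`. -/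
def BoundedSSYT.extend {lam κ : YoungDiagram} {n : ℕ} (hs : HStrip lam κ)
    (T : BoundedSSYT lam n) : BoundedSSYT κ (n + 1) where
  val :=
    { entry := fun i j => if (i, j) ∈ lam then T.1 i j else if (i, j) ∈ κ then n else 0
      row_weak' := by
        intro i j1 j2 hj hc
        have hc1 : (i, j1) ∈ κ := κ.up_left_mem le_rfl hj.le hc
        by_cases h2 : (i, j2) ∈ lam
        · have h1 : (i, j1) ∈ lam := lam.up_left_mem le_rfl hj.le h2
          simpa [h1, h2] using T.1.row_weak hj h2
        · by_cases h1 : (i, j1) ∈ lam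
          · simpa [h1, h2, hc] using (T.2 _ h1).le
          · simp [h1, h2, hc, hc1]
      col_strict' := by
        intro i1 i2 j hi hc
        obtain ⟨i, rfl⟩ : ∃ i, i2 = i + 1 := ⟨i2 - 1, by omega⟩
        have h1 : (i1, j) ∈ lam := lam.up_left_mem (by omega) le_rfl (hs.2 i j hc)
        by_cases h2 : (i + 1, j) ∈ lam
        · simpa [h1, h2] using T.1.col_strict hi h2
        · simpa [h1, h2, hc] using T.2 _ h1
      zeros' := by
        intro i j hc
        have h1 : (i, j) ∉ lam := fun h => hc (hs.1 h)
        simp [hc, h1] }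
  property := by
    intro c hc
    change (if (c.1, c.2) ∈ lam then T.1 c.1 c.2 else if (c.1, c.2) ∈ κ then n else 0) < n + 1
    split_ifs with h1
    · exact (T.2 _ h1).trans (Nat.lt_succ_self n)
    · exact Nat.lt_succ_self n
    · exact Nat.succ_pos n

theorem BoundedSSYT.extend_apply {lam κ : YoungDiagram} {n : ℕ} (hs : HStrip lam κ)
    (T : BoundedSSYT lam n) (i j : ℕ) :
    (T.extend hs).1 i j = if (i, j) ∈ lam then T.1 i j else if (i, j) ∈ κ then n else 0 := rfl

theorem BoundedSSYT.extend_lt_iff {lam κ : YoungDiagram} {n : ℕ} (hs : HStrip lam κ)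
    (T : BoundedSSYT lam n) (i j : ℕ) :
    (i, j) ∈ lam ↔ (i, j) ∈ κ ∧ (T.extend hs).1 i j < n := by
  rw [extend_apply]
  constructor
  · intro h
    exact ⟨hs.1 h, by simpa [h] using T.2 _ h⟩
  · rintro ⟨h1, h2⟩
    by_contra h
    simp [h, h1] at h2

/-- The cells of a tableau that hold a letter smaller than `n`. -/
def BoundedSSYT.innerShape {κ : YoungDiagram} {M : ℕ} (T : BoundedSSYT κ M) (n : ℕ) :
    YoungDiagram where
  cells := κ.cells.filter fun c => T.1 c.1 c.2 < n
  isLowerSet := by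
    rintro ⟨i, j⟩ ⟨i', j'⟩ ⟨hi, hj⟩ hc
    simp only [Finset.coe_filter, mem_cells, Set.mem_ofPred_eq] at *
    have h1 : (i, j') ∈ κ := κ.up_left_mem le_rfl hj hc.1
    exact ⟨κ.up_left_mem hi hj hc.1,
      ((T.1.col_weak hi h1).trans (T.1.row_weak_of_le hj hc.1)).trans_lt hc.2⟩

theorem BoundedSSYT.mem_innerShape {κ : YoungDiagram} {M : ℕ} (T : BoundedSSYT κ M) (n i j : ℕ) :
    (i, j) ∈ T.innerShape n ↔ (i, j) ∈ κ ∧ T.1 i j < n := by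
  change (i, j) ∈ Finset.filter _ _ ↔ _
  simp

/-- Strictness down the columns forces the cells holding the largest letter `n` to form a horizontal
strip; deleting them inverts `extend`. -/
theorem BoundedSSYT.extend_bijective (κ : YoungDiagram) (n : ℕ) :
    Function.Bijective (fun p : (lam : {lam : YoungDiagram // HStrip lam κ}) ×
      BoundedSSYT lam.1 n => p.2.extend p.1.2) := by
  constructor
  · rintro ⟨⟨lam, hl⟩, T⟩ ⟨⟨nu, hn⟩, T'⟩ h
    simp only at h
    have e : lam = nu := SetLike.ext fun ⟨i, j⟩ => by
      rw [extend_lt_iff hl T, extend_lt_iff hn T', h]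
    subst e
    congr 1
    refine BoundedSSYT.ext fun i j hc => ?_
    have h1 := T.extend_apply hl i j
    have h2 := T'.extend_apply hn i j
    rw [if_pos hc] at h1 h2
    rw [← h1, ← h2, h]
  · intro T
    have hs : HStrip (T.innerShape n) κ := by
      refine ⟨fun ⟨i, j⟩ hc => ((T.mem_innerShape n i j).1 hc).1, fun i j hc => ?_⟩
      refine (T.mem_innerShape n i j).2 ⟨κ.up_left_mem (Nat.le_succ i) le_rfl hc, ?_⟩
      have h1 := T.1.col_strict (Nat.lt_add_one i) hc
      have h2 := T.2 _ hc
      simp only at h2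
      omega
    refine ⟨⟨⟨T.innerShape n, hs⟩,
      ⟨{ entry := fun i j => if (i, j) ∈ T.innerShape n then T.1 i j else 0
         row_weak' := ?_, col_strict' := ?_, zeros' := ?_ }, ?_⟩⟩, ?_⟩
    · intro i j1 j2 hj hc
      have h1 := (T.innerShape n).up_left_mem le_rfl hj.le hc
      simpa [h1, hc] using T.1.row_weak hj (hs.1 hc)
    · intro i1 i2 j hi hc
      have h1 := (T.innerShape n).up_left_mem hi.le le_rfl hc
      simpa [h1, hc] using T.1.col_strict hi (hs.1 hc)
    · intro i j hc
      simp [hc]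
    · rintro ⟨i, j⟩ hc
      change (if (i, j) ∈ T.innerShape n then T.1 i j else 0) < n
      have hc' : (i, j) ∈ T.innerShape n := hc
      rw [if_pos hc']
      exact ((T.mem_innerShape n i j).1 hc').2
    · refine BoundedSSYT.ext fun i j hc => ?_
      rw [extend_apply]
      change (if (i, j) ∈ T.innerShape n then
        (if (i, j) ∈ T.innerShape n then T.1 i j else 0) else _) = _
      split_ifs with h1
      · rfl
      · have h2 := T.2 _ hc
        have h3 := (T.mem_innerShape n i j).not.1 h1
        simp only [hc, true_and] at h3 h2
        omega

/-- The branching rule: sort the tableaux by the shape occupied by the letters below `n`. -/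
theorem schurSum_succ (κ : YoungDiagram) (n : ℕ) (r : ℕ → R) :
    schurSum κ (n + 1) r = ∑ lam : {lam : YoungDiagram // HStrip lam κ},
      r n ^ (κ.cells.card - lam.1.cells.card) * schurSum lam.1 n r := by
  simp only [schurSum, Finset.mul_sum]
  rw [← Fintype.sum_sigma']
  refine (Fintype.sum_bijective _ (BoundedSSYT.extend_bijective κ n) _ _ ?_).symm
  rintro ⟨⟨lam, hl⟩, T⟩
  have hsub : lam.cells ⊆ κ.cells := hl.1
  simp only
  rw [← Finset.prod_sdiff hsub, ← Finset.card_sdiff_of_subset hsub, ← Finset.prod_const]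
  congr 1
  · refine Finset.prod_congr rfl fun c hc => ?_
    obtain ⟨h1, h2⟩ := Finset.mem_sdiff.1 hc
    rw [mem_cells] at h1 h2
    rw [BoundedSSYT.extend_apply, if_neg h2, if_pos h1]
  · refine Finset.prod_congr rfl fun c hc => ?_
    rw [BoundedSSYT.extend_apply, if_pos ((mem_cells c).1 hc)]

end Branching

/-! ### The dual RSK local rule and its inverse -/

section LocalRule

open YoungDiagram

/-- The carry of the dual Robinson–Schensted–Knuth local rule: `dualCarry lam mu nu a i = true`
when a letter is inserted into the row `i`. -/
def dualCarry (lam mu nu : YoungDiagram) (a : Bool) : ℕ → Bool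
  | 0 => a
  | i + 1 => decide (lam.rowLen i < mu.rowLen i) &&
      (dualCarry lam mu nu a i || decide (lam.rowLen i < nu.rowLen i))

/-- The row lengths of the shape produced by the dual Robinson–Schensted–Knuth local rule. -/
def dualRow (lam mu nu : YoungDiagram) (a : Bool) (i : ℕ) : ℕ :=
  max (nu.rowLen i + (dualCarry lam mu nu a i).toNat) (mu.rowLen i)

theorem dualCarry_succ_le {lam mu nu : YoungDiagram} (hv : VStrip lam mu) (a : Bool) (i : ℕ) :
    lam.rowLen i + (dualCarry lam mu nu a (i + 1)).toNat ≤ mu.rowLen i := by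
  have h := (vStrip_iff.1 hv i).1
  cases hc : dualCarry lam mu nu a (i + 1)
  · simpa using h
  · simp only [dualCarry, Bool.and_eq_true, decide_eq_true_eq] at hc
    simpa using hc.1

/-- A carry enters row `i + 1` only if `lam` is strictly shorter than `mu` in row `i`, which leaves
room for one box beyond `nu.rowLen (i + 1) ≤ lam.rowLen i`. -/
theorem dualRow_succ_le {lam mu nu : YoungDiagram} (hh : HStrip lam nu) (hv : VStrip lam mu)
    (a : Bool) (i : ℕ) : dualRow lam mu nu a (i + 1) ≤ mu.rowLen i := by
  have h1 := dualCarry_succ_le (nu := nu) hv a i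
  have h2 := (hStrip_iff.1 hh i).2
  have h3 := mu.rowLen_anti i (i + 1) (Nat.le_succ i)
  exact max_le (by omega) h3

theorem dualRow_antitone {lam mu nu : YoungDiagram} (hh : HStrip lam nu) (hv : VStrip lam mu)
    (a : Bool) : Antitone (dualRow lam mu nu a) :=
  antitone_nat_of_succ_le fun i => (dualRow_succ_le hh hv a i).trans (le_max_right _ _)

open Classical in
/-- The dual Robinson–Schensted–Knuth local rule: the shape `rho` opposite to `lam` in a square of
the growth diagram with corners `lam`, `mu`, `nu`, `rho` and the entry `a`. -/
noncomputable def dualLocal (lam mu nu : YoungDiagram) (a : Bool) : YoungDiagram :=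
  -- The new shape has at most one row more than `mu`, by `dualRow_succ_le`; `⊥` is a junk value.
  if h : HStrip lam nu ∧ VStrip lam mu then
    ofRowFun (dualRow lam mu nu a) (dualRow_antitone h.1 h.2 a) (mu.colLen 0 + 1)
  else ⊥

theorem rowLen_dualLocal {lam mu nu : YoungDiagram} (hh : HStrip lam nu) (hv : VStrip lam mu)
    (a : Bool) (i : ℕ) : (dualLocal lam mu nu a).rowLen i = dualRow lam mu nu a i := by
  rw [dualLocal, dif_pos ⟨hh, hv⟩, rowLen_ofRowFun]
  have h1 := dualRow_succ_le hh hv a (mu.colLen 0)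
  rw [rowLen_eq_zero_iff.2 le_rfl] at h1
  exact Nat.le_zero.1 h1

/-- Conservation of boxes in one row: whatever cannot be accommodated in row `i` is handed on to row
`i + 1`. -/
theorem dualRow_eq {lam mu nu : YoungDiagram} (hh : HStrip lam nu) (hv : VStrip lam mu)
    (a : Bool) (i : ℕ) :
    dualRow lam mu nu a i + lam.rowLen i + (dualCarry lam mu nu a (i + 1)).toNat =
      mu.rowLen i + nu.rowLen i + (dualCarry lam mu nu a i).toNat := by
  have h1 := vStrip_iff.1 hv i
  have h2 := (hStrip_iff.1 hh i).1
  simp only [dualRow, dualCarry]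
  cases dualCarry lam mu nu a i <;> by_cases h3 : lam.rowLen i < mu.rowLen i <;>
    by_cases h4 : lam.rowLen i < nu.rowLen i <;> simp [h3, h4] <;> omega

theorem hStrip_dualLocal {lam mu nu : YoungDiagram} (hh : HStrip lam nu) (hv : VStrip lam mu)
    (a : Bool) : HStrip mu (dualLocal lam mu nu a) := by
  refine hStrip_iff.2 fun i => ?_
  rw [rowLen_dualLocal hh hv, rowLen_dualLocal hh hv]
  exact ⟨le_max_right _ _, dualRow_succ_le hh hv a i⟩

theorem vStrip_dualLocal {lam mu nu : YoungDiagram} (hh : HStrip lam nu) (hv : VStrip lam mu)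
    (a : Bool) : VStrip nu (dualLocal lam mu nu a) := by
  refine vStrip_iff.2 fun i => ?_
  rw [rowLen_dualLocal hh hv]
  have h1 := vStrip_iff.1 hv i
  have h2 := (hStrip_iff.1 hh i).1
  have h3 := (dualCarry lam mu nu a i).toNat_le
  simp only [dualRow]
  omega

theorem card_dualLocal {lam mu nu : YoungDiagram} (hh : HStrip lam nu) (hv : VStrip lam mu)
    (a : Bool) : (dualLocal lam mu nu a).cells.card + lam.cells.card =
      mu.cells.card + nu.cells.card + a.toNat := by
  set rho := dualLocal lam mu nu a with hrho
  set N := max (max (rho.colLen 0) (lam.colLen 0)) (max (mu.colLen 0) (nu.colLen 0)) with hN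
  have hsum : ∀ n, (∑ i ∈ Finset.range n, rho.rowLen i) + (∑ i ∈ Finset.range n, lam.rowLen i) +
      (dualCarry lam mu nu a n).toNat = (∑ i ∈ Finset.range n, mu.rowLen i) +
        (∑ i ∈ Finset.range n, nu.rowLen i) + a.toNat := by
    intro n
    induction n with
    | zero => simp [dualCarry]
    | succ n ih =>
      have h := dualRow_eq hh hv a n
      rw [← rowLen_dualLocal hh hv a n, ← hrho] at h
      simp only [Finset.sum_range_succ]
      omega
  -- Row `N` of `mu` is empty, so no carry leaves it; hence the sums stop at `N + 1` rows.
  have h := hsum (N + 1)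
  have h0 := dualCarry_succ_le (nu := nu) hv a N
  rw [rowLen_eq_zero_iff.2 (by omega : mu.colLen 0 ≤ N)] at h0
  rw [card_eq_sum_rowLen (N := N + 1) (by omega), card_eq_sum_rowLen (κ := lam) (N := N + 1)
    (by omega), card_eq_sum_rowLen (κ := mu) (N := N + 1) (by omega),
    card_eq_sum_rowLen (κ := nu) (N := N + 1) (by omega)]
  omega

/-- The carries are recovered from the three other shapes, from the bottom row upwards. -/
theorem dualCarry_iff {lam mu nu rho : YoungDiagram} (hh : HStrip lam nu) (hv : VStrip lam mu)
    {a : Bool} (hr : dualLocal lam mu nu a = rho) (i : ℕ) :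
    dualCarry lam mu nu a i = true ↔ nu.rowLen i < rho.rowLen i ∧
      (dualCarry lam mu nu a (i + 1) = true ∨ mu.rowLen i ≤ nu.rowLen i) := by
  have h1 := vStrip_iff.1 hv i
  have h2 := (hStrip_iff.1 hh i).1
  rw [← hr, rowLen_dualLocal hh hv, dualRow, dualCarry]
  cases dualCarry lam mu nu a i <;> simp <;> omega

/-- An outgoing carry means `mu` has one box more than `lam` in row `i`; without one, `mu` or `nu`
agrees with `lam` there. -/
theorem rowLen_eq_of_dualLocal {lam mu nu : YoungDiagram} (hh : HStrip lam nu)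
    (hv : VStrip lam mu) (a : Bool) (i : ℕ) :
    lam.rowLen i = min (mu.rowLen i - (dualCarry lam mu nu a (i + 1)).toNat) (nu.rowLen i) := by
  have h1 := vStrip_iff.1 hv i
  have h2 := (hStrip_iff.1 hh i).1
  rw [dualCarry]
  cases dualCarry lam mu nu a i <;> by_cases h3 : lam.rowLen i < mu.rowLen i <;>
    by_cases h4 : lam.rowLen i < nu.rowLen i <;> simp [h3, h4] <;> omega

/-- `dualCarry_iff` computes the carries upwards from the first row below `mu`, where they vanish,
using `mu`, `nu`, `rho` only. They determine `lam`, and the carry into row `0` is the entry. -/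
theorem dualLocal_injective {lam lam' mu nu rho : YoungDiagram} {a a' : Bool}
    (hh : HStrip lam nu) (hv : VStrip lam mu) (hr : dualLocal lam mu nu a = rho)
    (hh' : HStrip lam' nu) (hv' : VStrip lam' mu) (hr' : dualLocal lam' mu nu a' = rho) :
    lam = lam' ∧ a = a' := by
  have hzero : ∀ {l b}, VStrip l mu → ∀ i, mu.colLen 0 ≤ i →
      dualCarry l mu nu b (i + 1) = false := by
    intro l b hl i hi
    have h0 := dualCarry_succ_le (nu := nu) hl b i
    rw [rowLen_eq_zero_iff.2 hi] at h0
    cases hc : dualCarry l mu nu b (i + 1)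
    · rfl
    · simp [hc] at h0
  have hcarry : ∀ k i, mu.colLen 0 + 1 ≤ i + k →
      dualCarry lam mu nu a i = dualCarry lam' mu nu a' i := by
    intro k
    induction k with
    | zero =>
      intro i hi
      obtain ⟨i, rfl⟩ : ∃ j, i = j + 1 := ⟨i - 1, by omega⟩
      rw [hzero hv i (by omega), hzero hv' i (by omega)]
    | succ k ih =>
      intro i hi
      rw [Bool.eq_iff_iff, dualCarry_iff hh hv hr, dualCarry_iff hh' hv' hr', ih (i + 1) (by omega)]
  refine ⟨ext_rowLen fun i => ?_, hcarry (mu.colLen 0 + 1) 0 (by omega)⟩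
  rw [rowLen_eq_of_dualLocal hh hv a i, rowLen_eq_of_dualLocal hh' hv' a' i,
    hcarry (mu.colLen 0 + 1) (i + 1) (by omega)]

open Classical in
/-- The carries of the inverse of the dual Robinson–Schensted–Knuth local rule. -/
noncomputable def inverseCarry (mu nu rho : YoungDiagram) (i : ℕ) : Bool :=
  decide (∃ k, i ≤ k ∧ (∀ l, i ≤ l → l ≤ k → nu.rowLen l < rho.rowLen l) ∧
    mu.rowLen k ≤ nu.rowLen k)

/-- The existential defining `inverseCarry` is the unrolled solution of the recursion that
`dualCarry_iff` imposes on true carries. -/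
theorem inverseCarry_iff (mu nu rho : YoungDiagram) (i : ℕ) :
    inverseCarry mu nu rho i = true ↔ nu.rowLen i < rho.rowLen i ∧
      (inverseCarry mu nu rho (i + 1) = true ∨ mu.rowLen i ≤ nu.rowLen i) := by
  simp only [inverseCarry, decide_eq_true_eq]
  constructor
  · rintro ⟨k, hik, hl, hk⟩
    refine ⟨hl i le_rfl hik, ?_⟩
    rcases hik.eq_or_lt with rfl | hlt
    · exact Or.inr hk
    · exact Or.inl ⟨k, hlt, fun l h1 h2 => hl l (by omega) h2, hk⟩
  · rintro ⟨hi, ⟨k, hik, hl, hk⟩ | h⟩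
    · refine ⟨k, by omega, fun l h1 h2 => ?_, hk⟩
      rcases h1.eq_or_lt with rfl | hlt
      · exact hi
      · exact hl l hlt h2
    · exact ⟨i, le_rfl, fun l h1 h2 => by rwa [le_antisymm h2 h1], h⟩

theorem dualLocal_surjective {mu nu rho : YoungDiagram} (hh : HStrip mu rho)
    (hv : VStrip nu rho) :
    ∃ lam a, HStrip lam nu ∧ VStrip lam mu ∧ dualLocal lam mu nu a = rho := by
  set c := inverseCarry mu nu rho with hc
  -- The only candidate for `lam`, dictated by `rowLen_eq_of_dualLocal`; the entry will be `c 0`.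
  set f : ℕ → ℕ := fun i => min (mu.rowLen i - (c (i + 1)).toNat) (nu.rowLen i) with hf
  have hcn : ∀ i, c i = true ↔ nu.rowLen i < rho.rowLen i ∧
      (c (i + 1) = true ∨ mu.rowLen i ≤ nu.rowLen i) := inverseCarry_iff mu nu rho
  have hH := hStrip_iff.1 hh
  have hV := vStrip_iff.1 hv
  have key : ∀ i, f i ≤ nu.rowLen i ∧ nu.rowLen (i + 1) ≤ f i ∧ f i ≤ mu.rowLen i ∧
      mu.rowLen i ≤ f i + 1 ∧ (c (i + 1) = true → 1 ≤ mu.rowLen i) := by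
    intro i
    have h1 := hH i
    have h2 := hV i
    have h3 := hV (i + 1)
    have h4 := nu.rowLen_anti i (i + 1) (Nat.le_succ i)
    simp only [hf]
    cases hci : c (i + 1)
    · simp only [Bool.toNat_false]
      refine ⟨?_, ?_, ?_, ?_, by simp⟩ <;> omega
    · have h5 := ((hcn (i + 1)).1 hci).1
      simp only [Bool.toNat_true]
      refine ⟨?_, ?_, ?_, ?_, fun _ => ?_⟩ <;> omega
  have hanti : Antitone f :=
    antitone_nat_of_succ_le fun i => (key (i + 1)).1.trans (key i).2.1
  have h0 : f (nu.colLen 0) = 0 :=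
    Nat.le_zero.1 ((key _).1.trans (rowLen_eq_zero_iff.2 le_rfl).le)
  set lam := ofRowFun f hanti (nu.colLen 0) with hlam
  have hrow : ∀ i, lam.rowLen i = f i := rowLen_ofRowFun hanti h0
  have h1 : HStrip lam nu := hStrip_iff.2 fun i => by
    rw [hrow]; exact ⟨(key i).1, (key i).2.1⟩
  have h2 : VStrip lam mu := vStrip_iff.2 fun i => by
    rw [hrow]; exact ⟨(key i).2.2.1, (key i).2.2.2.1⟩
  -- The carries propagated downwards from the entry `c 0` reproduce those read off from `rho`.
  have hcarry : ∀ i, dualCarry lam mu nu (c 0) i = c i := by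
    intro i
    induction i with
    | zero => rfl
    | succ i ih =>
      rw [dualCarry, ih, hrow, Bool.eq_iff_iff]
      simp only [Bool.and_eq_true, Bool.or_eq_true, decide_eq_true_eq, hcn i]
      have k1 := key i
      have h1 := hH i
      have h2 := hV i
      simp only [hf] at k1 ⊢
      cases hci : c (i + 1)
      · simp
        omega
      · simp [hci] at k1 ⊢
        omega
  refine ⟨lam, c 0, h1, h2, ext_rowLen fun i => ?_⟩
  rw [rowLen_dualLocal h1 h2, dualRow, hcarry]
  have k1 := key i
  have h1 := hH i
  have h2 := hV i
  have h3 := hcn i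
  cases hci : c i
  · simp only [hci, Bool.false_eq_true, false_iff, not_and, not_or] at h3
    simp only [Bool.toNat_false]
    by_cases h4 : nu.rowLen i < rho.rowLen i
    · have := (h3 h4).2
      omega
    · omega
  · have := (h3.1 hci).1
    simp only [Bool.toNat_true]
    omega

end LocalRule

/-! ### Growth diagrams and the weight of the final shape -/

section GrowthDiagram

open YoungDiagram
open scoped ENNReal

/-- The indicator of a proposition, with values in the extended non-negative reals. -/
noncomputable def indic (P : Prop) : ℝ≥0∞ := open Classical in if P then 1 else 0

theorem indic_pos {P : Prop} (h : P) : indic P = 1 := if_pos h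

theorem indic_neg {P : Prop} (h : ¬P) : indic P = 0 := if_neg h

theorem indic_and (P Q : Prop) : indic (P ∧ Q) = indic P * indic Q := by
  by_cases hP : P <;> by_cases hQ : Q <;> simp [indic, hP, hQ]

theorem tsum_indic_eq {α : Type*} (x : α) (f : α → ℝ≥0∞) :
    ∑' y, indic (x = y) * f y = f x := by
  rw [tsum_eq_single x fun y hy => by rw [indic_neg hy.symm, zero_mul], indic_pos rfl, one_mul]

theorem tsum_indic_subtype {α : Type*} (P : α → Prop) [Fintype {x // P x}] (f : α → ℝ≥0∞) :
    ∑' x, indic (P x) * f x = ∑ x : {x // P x}, f x.1 := by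
  rw [← tsum_fintype (L := .unconditional _), show ∑' x : {x // P x}, f x.1 = _ from tsum_subtype ({y | P y}) f]
  refine tsum_congr fun x => ?_
  by_cases hx : P x
  · rw [indic_pos hx, one_mul, Set.indicator_of_mem (show x ∈ {y | P y} from hx)]
  · rw [indic_neg hx, zero_mul, Set.indicator_of_notMem (show x ∉ {y | P y} from hx)]

theorem Fin.sum_pi_snoc {α M : Type*} [Fintype α] [AddCommMonoid M] {n : ℕ}
    (F : (Fin (n + 1) → α) → M) :
    ∑ f, F f = ∑ f : Fin n → α, ∑ x : α, F (Fin.snoc f x) := by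
  rw [← Fintype.sum_prod_type_right' (fun x f => F (Fin.snoc f x))]
  exact (Fintype.sum_equiv (Fin.snocEquiv fun _ : Fin (n + 1) => α) _ _ fun _ => rfl).symm

/-- Sequences of `m` partitions, to be thought of as starting from the empty partition. -/
def ShapeChain : ℕ → Type
  | 0 => Unit
  | m + 1 => ShapeChain m × YoungDiagram

namespace ShapeChain

instance : Subsingleton (ShapeChain 0) := inferInstanceAs (Subsingleton Unit)

/-- The last partition. -/
def last : (m : ℕ) → ShapeChain m → YoungDiagram
  | 0, _ => ⊥
  | _ + 1, Y => Y.2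

/-- Successive partitions differ by vertical strips. -/
def IsVertical : (m : ℕ) → ShapeChain m → Prop
  | 0, _ => True
  | m + 1, Y => IsVertical m Y.1 ∧ VStrip (last m Y.1) Y.2

/-- The chain of empty partitions. -/
def empty : (m : ℕ) → ShapeChain m
  | 0 => ()
  | m + 1 => (empty m, ⊥)

/-- Add a column of squares with the entries `a` to the growth diagram. -/
noncomputable def next : (m : ℕ) → ShapeChain m → (Fin m → Bool) → ShapeChain m
  | 0, Y, _ => Y
  | m + 1, Y, a =>
    (next m Y.1 (Fin.init a), dualLocal (last m Y.1) Y.2 (last m (next m Y.1 (Fin.init a)))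
      (a (Fin.last m)))

/-- The last column of the growth diagram of a `0`-`1` matrix with `n` columns of height `m`. -/
noncomputable def growth (m : ℕ) : (n : ℕ) → (Fin n → Fin m → Bool) → ShapeChain m
  | 0, _ => empty m
  | n + 1, A => next m (growth m n (Fin.init A)) (A (Fin.last n))

theorem last_empty (m : ℕ) : last m (empty m) = ⊥ := by
  cases m <;> rfl

theorem isVertical_empty (m : ℕ) : IsVertical m (empty m) := by
  induction m with
  | zero => trivial
  | succ m ih =>
    refine ⟨ih, ?_⟩
    change VStrip (last m (empty m)) ⊥
    rw [last_empty]
    exact ⟨le_rfl, fun _ _ h => absurd h (notMem_bot _)⟩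

theorem eq_empty_of_last_eq_bot {m : ℕ} {Z : ShapeChain m} (hZ : IsVertical m Z)
    (h : last m Z = ⊥) : empty m = Z := by
  induction m with
  | zero => rfl
  | succ m ih =>
    have h' : Z.2 = ⊥ := h
    have h1 : last m Z.1 = ⊥ := le_bot_iff.1 (h' ▸ hZ.2.1)
    exact Prod.ext (ih hZ.1 h1) h'.symm

end ShapeChain

/-- The weighted form of the bijection between the two sides of the local rule. -/
theorem tsum_dualLocal (mu nu rho : YoungDiagram) (r : ℝ≥0∞) :
    ∑' lam, ∑ b : Bool, indic (HStrip lam nu) * indic (VStrip lam mu) *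
        indic (dualLocal lam mu nu b = rho) *
        (r ^ (nu.cells.card - lam.cells.card) * r ^ b.toNat) =
      indic (VStrip nu rho) * indic (HStrip mu rho) * r ^ (rho.cells.card - mu.cells.card) := by
  by_cases hrho : VStrip nu rho ∧ HStrip mu rho
  · obtain ⟨lam, a, hh, hv, hr⟩ := dualLocal_surjective hrho.2 hrho.1
    rw [tsum_eq_single lam, Finset.sum_eq_single a]
    · rw [indic_pos hh, indic_pos hv, indic_pos hr, indic_pos hrho.1, indic_pos hrho.2, ← pow_add]
      have h1 := card_dualLocal hh hv a
      have h2 := Finset.card_le_card (show lam.cells ⊆ nu.cells from hh.1)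
      have h3 := Finset.card_le_card (show mu.cells ⊆ rho.cells from hrho.2.1)
      rw [hr] at h1
      simp only [one_mul]
      congr 1
      omega
    · intro b _ hb
      rw [indic_neg (P := dualLocal lam mu nu b = rho), mul_zero, zero_mul]
      exact fun h => hb (dualLocal_injective hh hv h hh hv hr).2
    · exact fun h => absurd (Finset.mem_univ a) h
    · intro lam' hne
      refine Finset.sum_eq_zero fun b _ => ?_
      rw [← indic_and, ← indic_and, indic_neg, zero_mul]
      rintro ⟨⟨hh', hv'⟩, hr'⟩
      exact hne (dualLocal_injective hh' hv' hr' hh hv hr).1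
  · rw [← indic_and, indic_neg hrho, zero_mul]
    refine ENNReal.tsum_eq_zero.2 fun lam => Finset.sum_eq_zero fun b _ => ?_
    rw [← indic_and, ← indic_and, indic_neg, zero_mul]
    rintro ⟨⟨hh, hv⟩, rfl⟩
    exact hrho ⟨vStrip_dualLocal hh hv b, hStrip_dualLocal hh hv b⟩

/-- The local bijection is applied to the squares of one column from the top down. Each square
passes the weight of its lower horizontal edge and of its entry to its upper edge, so only the top
edge survives. Values in `ℝ≥0∞` make every interchange of sums legitimate. -/
theorem tsum_shapeChain_next (r : ℝ≥0∞) (m : ℕ) (Z : ShapeChain m) (f : YoungDiagram → ℝ≥0∞) :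
    ∑' Y : ShapeChain m, ∑ a : Fin m → Bool, indic (Y.IsVertical) * indic (Y.next m a = Z) *
        (∏ i, r ^ (a i).toNat) * f Y.last =
      indic Z.IsVertical * ∑' lam, indic (HStrip lam Z.last) *
        (r ^ (Z.last.cells.card - lam.cells.card) * f lam) := by
  induction m generalizing f with
  | zero =>
    have h1 : ∀ lam, HStrip lam (⊥ : YoungDiagram) ↔ ⊥ = lam := fun lam =>
      ⟨fun h => (le_bot_iff.1 h.1).symm,
        fun h => h ▸ ⟨le_rfl, fun _ _ h => absurd h (notMem_bot _)⟩⟩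
    simp only [ShapeChain.last, h1, tsum_indic_eq]
    rw [tsum_eq_single Z fun Y hY => absurd (Subsingleton.elim Y Z) hY]
    simp [indic, ShapeChain.IsVertical, ShapeChain.next]
  | succ m ih =>
    obtain ⟨Z, rho⟩ := Z
    -- The top square is absorbed into a function of its corner `lam`; this is why the induction is
    -- over arbitrary `f`.
    set g : YoungDiagram → ℝ≥0∞ := fun lam => ∑' mu, ∑ b : Bool, indic (VStrip lam mu) *
      indic (dualLocal lam mu Z.last b = rho) * (r ^ b.toNat * f mu) with hg
    have h1 := ih Z g
    calc _ = ∑' Y : ShapeChain m, ∑' mu : YoungDiagram, ∑ a : Fin m → Bool, ∑ b : Bool,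
            indic Y.IsVertical * indic (Y.next m a = Z) * (∏ i, r ^ (a i).toNat) *
            (indic (VStrip Y.last mu) * indic (dualLocal Y.last mu Z.last b = rho) *
              (r ^ b.toNat * f mu)) := by
          refine (ENNReal.tsum_prod' (α := ShapeChain m) (β := YoungDiagram)).trans ?_
          refine tsum_congr fun Y => tsum_congr fun mu => ?_
          rw [Fin.sum_pi_snoc]
          refine Finset.sum_congr rfl fun a _ => Finset.sum_congr rfl fun b _ => ?_
          have e1 : (ShapeChain.next (m + 1) (Y, mu) (Fin.snoc a b) = (Z, rho)) ↔
              Y.next m a = Z ∧ dualLocal Y.last mu Z.last b = rho := by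
            set c : Fin (m + 1) → Bool := Fin.snoc a b with hc
            change (ShapeChain.next m Y (Fin.init c), dualLocal Y.last mu
              (Y.next m (Fin.init c)).last (c (Fin.last m))) = _ ↔ _
            rw [hc, Fin.init_snoc, Fin.snoc_last]
            refine Prod.mk_inj.trans (and_congr_right fun h => ?_)
            rw [h]
          have e2 : ShapeChain.IsVertical (m + 1) (Y, mu) ↔ Y.IsVertical ∧ VStrip Y.last mu :=
            Iff.rfl
          rw [e1, e2, indic_and, indic_and, Fin.prod_univ_castSucc]
          simp only [Fin.snoc_castSucc, Fin.snoc_last]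
          change _ * f mu = _
          ring
      _ = ∑' Y : ShapeChain m, ∑ a : Fin m → Bool, indic Y.IsVertical *
            indic (Y.next m a = Z) * (∏ i, r ^ (a i).toNat) * g Y.last := by
          refine tsum_congr fun Y => ?_
          rw [Summable.tsum_finsetSum fun _ _ => ENNReal.summable]
          refine Finset.sum_congr rfl fun a _ => ?_
          simp only [hg, ← ENNReal.tsum_mul_left, ← Finset.mul_sum]
      _ = _ := h1
      _ = indic Z.IsVertical * ∑' mu, f mu * ∑' lam, ∑ b : Bool,
            indic (HStrip lam Z.last) * indic (VStrip lam mu) *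
            indic (dualLocal lam mu Z.last b = rho) *
            (r ^ (Z.last.cells.card - lam.cells.card) * r ^ b.toNat) := by
          congr 1
          simp only [hg, ← ENNReal.tsum_mul_left]
          rw [ENNReal.tsum_comm]
          refine tsum_congr fun mu => tsum_congr fun lam => ?_
          simp only [Finset.mul_sum]
          refine Finset.sum_congr rfl fun b _ => ?_
          ring
      _ = _ := by
          have e2 : ShapeChain.IsVertical (m + 1) (Z, rho) ↔ Z.IsVertical ∧ VStrip Z.last rho :=
            Iff.rfl
          rw [e2, indic_and, mul_assoc]
          congr 1
          rw [← ENNReal.tsum_mul_left]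
          refine tsum_congr fun mu => ?_
          rw [tsum_dualLocal]
          change _ = _ * (indic (HStrip mu rho) * (r ^ (rho.cells.card - _) * _))
          ring

/-- Adding a column reproduces the branching rule on the top shapes, so the weight sees the chain
only through its last shape. -/
theorem sum_growth (r : ℕ → ℝ≥0∞) (m n : ℕ) (Z : ShapeChain m) :
    ∑ A : Fin n → Fin m → Bool, (∏ k : Fin n, ∏ i, r k ^ (A k i).toNat) *
        indic (ShapeChain.growth m n A = Z) =
      indic Z.IsVertical * schurSum Z.last n r := by
  classical
  induction n generalizing Z with
  | zero =>
    rw [Fintype.sum_unique, schurSum_zero]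
    simp only [Finset.univ_eq_empty, Finset.prod_empty, one_mul, ShapeChain.growth]
    by_cases h : Z.IsVertical ∧ Z.last = ⊥
    · rw [indic_pos h.1, if_pos h.2, indic_pos (ShapeChain.eq_empty_of_last_eq_bot h.1 h.2),
        one_mul]
    · rw [indic_neg]
      · by_cases h1 : Z.IsVertical
        · rw [if_neg fun h2 => h ⟨h1, h2⟩, mul_zero]
        · rw [indic_neg h1, zero_mul]
      · rintro rfl
        exact h ⟨ShapeChain.isVertical_empty m, ShapeChain.last_empty m⟩
  | succ n ih =>
    rw [Fin.sum_pi_snoc]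
    calc _ = ∑ A : Fin n → Fin m → Bool, ∑ a : Fin m → Bool, ∑' Y : ShapeChain m,
          indic (ShapeChain.growth m n A = Y) * ((∏ k : Fin n, ∏ i, r k ^ (A k i).toNat) *
            (indic (Y.next m a = Z) * ∏ i, r n ^ (a i).toNat)) := by
          refine Finset.sum_congr rfl fun A _ => Finset.sum_congr rfl fun a _ => ?_
          rw [tsum_indic_eq, ShapeChain.growth, Fin.init_snoc, Fin.snoc_last,
            Fin.prod_univ_castSucc]
          simp only [Fin.snoc_castSucc, Fin.snoc_last, Fin.val_castSucc, Fin.val_last]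
          ring
      _ = ∑' Y : ShapeChain m, ∑ a : Fin m → Bool, indic (Y.IsVertical) *
            indic (Y.next m a = Z) * (∏ i, r n ^ (a i).toNat) * schurSum Y.last n r := by
          simp only [← Summable.tsum_finsetSum fun _ _ => ENNReal.summable]
          refine tsum_congr fun Y => ?_
          rw [Finset.sum_comm]
          refine Finset.sum_congr rfl fun a _ => ?_
          rw [show ∀ x y z w : ℝ≥0∞, x * y * z * w = (x * w) * (y * z) from fun _ _ _ _ => by ring,
            ← ih, Finset.sum_mul]
          exact Finset.sum_congr rfl fun A _ => by ring
      _ = _ := by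
          rw [tsum_shapeChain_next (r n) m Z fun κ => schurSum κ n r, tsum_indic_subtype, schurSum_succ]

theorem ssytCount_transpose_succ (κ : YoungDiagram) (m : ℕ) :
    (ssytCount κ.transpose (m + 1) : ℝ≥0∞) =
      ∑' lam, indic (VStrip lam κ) * (ssytCount lam.transpose m : ℝ≥0∞) := by
  rw [← schurSum_one, schurSum_succ]
  simp only [one_pow, one_mul, schurSum_one]
  rw [← tsum_indic_subtype (fun lam => HStrip lam κ.transpose)
    (fun lam => (ssytCount lam m : ℝ≥0∞))]
  rw [← transposeOrderIso.toEquiv.tsum_eq]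
  refine tsum_congr fun lam => ?_
  change indic (HStrip lam.transpose κ.transpose) * (ssytCount lam.transpose m : ℝ≥0∞) = _
  rw [hStrip_transpose]

/-- Transposed, a vertical chain ending at `κ` is a semistandard tableau of shape `κ'` with `m`
letters. -/
theorem tsum_isVertical (m : ℕ) (F : YoungDiagram → ℝ≥0∞) :
    ∑' Z : ShapeChain m, indic Z.IsVertical * F Z.last =
      ∑' κ, (ssytCount κ.transpose m : ℝ≥0∞) * F κ := by
  classical
  induction m generalizing F with
  | zero =>
    rw [tsum_eq_single (ShapeChain.empty 0) fun Y hY => absurd (Subsingleton.elim Y _) hY, tsum_eq_single (⊥ : YoungDiagram)]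
    · rw [← schurSum_one, (show (⊥ : YoungDiagram).transpose = ⊥ from rfl), schurSum_bot]
      rw [indic_pos (ShapeChain.isVertical_empty 0)]
      rfl
    · intro κ hκ
      rw [← schurSum_one, schurSum_zero_of_ne_bot, zero_mul]
      exact fun h => hκ (transpose_eq_iff_eq_transpose.1 h)
  | succ m ih =>
    calc _ = ∑' Z : ShapeChain m, indic Z.IsVertical *
            ∑' κ, indic (VStrip Z.last κ) * F κ := by
          refine (ENNReal.tsum_prod' (α := ShapeChain m) (β := YoungDiagram)).trans ?_
          refine tsum_congr fun Z => ?_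
          rw [← ENNReal.tsum_mul_left]
          refine tsum_congr fun κ => ?_
          rw [← mul_assoc, ← indic_and]
          rfl
      _ = _ := by
          rw [ih fun lam => ∑' κ, indic (VStrip lam κ) * F κ]
          simp only [ssytCount_transpose_succ, ← ENNReal.tsum_mul_left, ← ENNReal.tsum_mul_right]
          rw [ENNReal.tsum_comm]
          refine tsum_congr fun κ => tsum_congr fun lam => ?_
          ring

theorem sum_growth_last (r : ℕ → ℝ≥0∞) (m n : ℕ) (F : YoungDiagram → ℝ≥0∞) :
    ∑ A : Fin n → Fin m → Bool, (∏ k : Fin n, ∏ i, r k ^ (A k i).toNat) *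
        F (ShapeChain.growth m n A).last =
      ∑' κ, (ssytCount κ.transpose m : ℝ≥0∞) * (schurSum κ n r * F κ) := by
  rw [← tsum_isVertical m fun κ => schurSum κ n r * F κ]
  simp only [← mul_assoc, ← sum_growth, Finset.sum_mul]
  rw [Summable.tsum_finsetSum fun _ _ => ENNReal.summable]
  refine Finset.sum_congr rfl fun A _ => ?_
  rw [← tsum_indic_eq (ShapeChain.growth m n A) fun Z => F Z.last, ← ENNReal.tsum_mul_left]
  exact tsum_congr fun Z => by ring

/-! ### Heights as first rows -/

/-- The heights at one site from the heights `g` at its left neighbour. -/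
def nextHeight (g : ℕ → ℕ) (b : ℕ → Bool) : ℕ → ℕ
  | 0 => 0
  | s + 1 => max (g (s + 1)) (nextHeight g b s + (b s).toNat)

/-- The heights at the site `n - 1`, counted from the first time at which they are finite. -/
def growthHeight (a : ℕ → ℕ → Bool) : ℕ → ℕ → ℕ
  | 0 => fun _ => 0
  | n + 1 => nextHeight (growthHeight a n) (a n)

namespace ShapeChain

/-- The first rows of the partitions of a chain have the lengths `g 1, g 2, …`. -/
def HasFirstRows (g : ℕ → ℕ) : (m : ℕ) → ShapeChain m → Prop
  | 0, _ => g 0 = 0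
  | m + 1, Y => HasFirstRows g m Y.1 ∧ Y.2.rowLen 0 = g (m + 1)

theorem HasFirstRows.last {g : ℕ → ℕ} {m : ℕ} {Y : ShapeChain m} (h : HasFirstRows g m Y) :
    (ShapeChain.last m Y).rowLen 0 = g m := by
  cases m with
  | zero => exact (rowLen_bot 0).trans (Eq.symm h)
  | succ m => exact h.2

/-- The carry into row `0` is the entry itself, so there the local rule reads `rho_0 = max (nu_0 +
a) mu_0`, the recursion of `nextHeight`. -/
theorem hasFirstRows_next {g : ℕ → ℕ} {b : ℕ → Bool} {m : ℕ} {Y : ShapeChain m}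
    (hY : IsVertical m Y) (h : HasFirstRows g m Y) :
    HasFirstRows (nextHeight g b) m (Y.next m fun i => b i) ∧
      IsVertical m (Y.next m fun i => b i) ∧
      HStrip (ShapeChain.last m Y) (ShapeChain.last m (Y.next m fun i => b i)) := by
  induction m with
  | zero => exact ⟨rfl, trivial, le_rfl, fun _ _ h => absurd h (notMem_bot _)⟩
  | succ m ih =>
    obtain ⟨h1, h2, h3⟩ := ih hY.1 h.1
    refine ⟨⟨h1, ?_⟩, ⟨h2, vStrip_dualLocal h3 hY.2 _⟩, hStrip_dualLocal h3 hY.2 _⟩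
    refine (rowLen_dualLocal h3 hY.2 _ 0).trans ?_
    rw [dualRow, dualCarry, nextHeight, max_comm, ← h.2, h1.last]
    rfl

theorem hasFirstRows_growth (a : ℕ → ℕ → Bool) (m n : ℕ) :
    HasFirstRows (growthHeight a n) m (growth m n fun k i => a k i) ∧
      IsVertical m (growth m n fun k i => a k i) := by
  induction n with
  | zero =>
    refine ⟨?_, isVertical_empty m⟩
    change HasFirstRows _ m (empty m)
    induction m with
    | zero => rfl
    | succ m ih => exact ⟨ih, rowLen_bot 0⟩
  | succ n ih =>
    have h := hasFirstRows_next (b := a n) ih.2 ih.1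
    exact ⟨h.1, h.2.1⟩

end ShapeChain

end GrowthDiagram

/-! ### Jacobi–Trudi determinants under multiplication and division of the symbol -/

section JacobiTrudi

open YoungDiagram

variable {R : Type*} [CommRing R]

/-- The Jacobi–Trudi determinant `det (c (f i - i + j))` of a sequence of coefficients. -/
def jacobiTrudi (c : ℤ → R) (h : ℕ) (f : Fin h → ℕ) : R :=
  (Matrix.of fun i j : Fin h => c ((f i : ℤ) - (i : ℤ) + (j : ℤ))).det

/-- The row lengths of a Young diagram, up to the row `h`. -/
def YoungDiagram.rows (lam : YoungDiagram) (h : ℕ) (i : Fin h) : ℕ := lam.rowLen i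

theorem YoungDiagram.colLen_le_of_le {lam κ : YoungDiagram} (hle : lam ≤ κ) :
    lam.colLen 0 ≤ κ.colLen 0 := by
  rw [← rowLen_eq_zero_iff]
  exact Nat.le_zero.1 ((le_iff_rowLen.1 hle _).trans (rowLen_eq_zero_iff.2 le_rfl).le)

theorem YoungDiagram.ext_rows {lam κ : YoungDiagram} {h : ℕ} (hl : lam.colLen 0 ≤ h)
    (hk : κ.colLen 0 ≤ h) (hr : ∀ i : Fin h, lam.rowLen i = κ.rowLen i) : lam = κ := by
  refine ext_rowLen fun i => ?_
  by_cases hi : i < h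
  · exact hr ⟨i, hi⟩
  · rw [rowLen_eq_zero_iff.2 (by omega), rowLen_eq_zero_iff.2 (by omega)]

theorem YoungDiagram.exists_rows {h : ℕ} (f : Fin h → ℕ)
    (hf : ∀ i : ℕ, ∀ hi : i + 1 < h, f ⟨i + 1, hi⟩ ≤ f ⟨i, by omega⟩) :
    ∃ lam : YoungDiagram, lam.colLen 0 ≤ h ∧ ∀ i : Fin h, lam.rowLen i = f i := by
  set g : ℕ → ℕ := fun i => if hi : i < h then f ⟨i, hi⟩ else 0 with hg
  have hanti : Antitone g := antitone_nat_of_succ_le fun i => by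
    simp only [hg]
    by_cases hi : i + 1 < h
    · rw [dif_pos hi, dif_pos (by omega)]
      exact hf i hi
    · rw [dif_neg hi]
      exact Nat.zero_le _
  have h0 : g h = 0 := by simp [hg]
  refine ⟨ofRowFun g hanti h, ?_, fun i => ?_⟩
  · rw [← rowLen_eq_zero_iff, rowLen_ofRowFun hanti h0, h0]
  · rw [rowLen_ofRowFun hanti h0]
    simp [hg]

theorem det_sum_rows {n α : Type*} [Fintype n] [DecidableEq n] (A : n → Finset α)
    (g : n → α → n → R) :
    (Matrix.of fun i j => ∑ a ∈ A i, g i a j).det =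
      ∑ f ∈ Fintype.piFinset A, (Matrix.of fun i j => g i (f i) j).det := by
  have h1 := (Matrix.detRowAlternating (n := n) (R := R)).toMultilinearMap.map_sum_finset g A
  refine Eq.trans ?_ h1
  refine congrArg Matrix.det ?_
  ext i j
  simp

theorem jacobiTrudi_eq_zero_of_rows {c : ℤ → R} {h : ℕ} {F : Fin h → ℤ} {i j : Fin h}
    (hij : i ≠ j) (hF : F i - i = F j - j) :
    (Matrix.of fun i j : Fin h => c (F i - (i : ℤ) + (j : ℤ))).det = 0 :=
  Matrix.det_zero_of_row_eq hij (funext fun k => by simp [hF])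

/-- The expansion of a Jacobi–Trudi determinant on multiplying the generating function of the
coefficients by `1 + x z`. -/
theorem jacobiTrudi_add_mul {c : ℤ → R} (hc : ∀ a < 0, c a = 0) (x : R) {h : ℕ}
    {lam : YoungDiagram} (hl : lam.colLen 0 ≤ h) :
    jacobiTrudi (fun a => c a + x * c (a - 1)) h (lam.rows h) =
      ∑ κ : {κ : YoungDiagram // VStrip κ lam},
        x ^ (lam.cells.card - κ.1.cells.card) * jacobiTrudi c h (κ.1.rows h) := by
  have hcol : ∀ κ : {κ : YoungDiagram // VStrip κ lam}, κ.1.colLen 0 ≤ h := fun κ =>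
    (colLen_le_of_le κ.2.1).trans hl
  have hexp : jacobiTrudi (fun a => c a + x * c (a - 1)) h (lam.rows h) =
      ∑ e : Fin h → Bool, (∏ i, x ^ (e i).toNat) * (Matrix.of fun i j : Fin h =>
        -- Multilinearity in the rows: `e i` records whether row `i` takes the shifted term.
        c (((lam.rowLen i : ℤ) - ((e i).toNat : ℤ)) - (i : ℤ) + (j : ℤ))).det := by
    have h1 := det_sum_rows (fun _ : Fin h => (Finset.univ : Finset Bool)) (fun i b j =>
      x ^ b.toNat * c (((lam.rowLen i : ℤ) - (b.toNat : ℤ)) - (i : ℤ) + ((j : Fin h) : ℤ)))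
    rw [Fintype.piFinset_univ] at h1
    refine Eq.trans ?_ (h1.trans (Finset.sum_congr rfl fun e _ => ?_))
    · refine congrArg Matrix.det ?_
      ext i j
      simp only [Matrix.of_apply, Fintype.sum_bool, Bool.toNat_true, Bool.toNat_false, pow_one,
        pow_zero, one_mul, YoungDiagram.rows, Nat.cast_one, Nat.cast_zero, sub_zero]
      rw [add_comm]
      congr 3
      ring
    · rw [← Matrix.det_mul_column]
      rfl
  rw [hexp]
  symm
  refine Fintype.sum_of_injective (fun (κ : {κ : YoungDiagram // VStrip κ lam}) (i : Fin h) =>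
    decide (κ.1.rowLen i < lam.rowLen i)) ?_ _ _ ?_ ?_
  · intro κ κ' he
    refine Subtype.ext (ext_rows (hcol κ) (hcol κ') fun i => ?_)
    have h1 := congrFun he i
    have h2 := vStrip_iff.1 κ.2 i
    have h3 := vStrip_iff.1 κ'.2 i
    simp only [decide_eq_decide] at h1
    omega
  · intro e he
    have hdet : (Matrix.of fun i j : Fin h =>
        c (((lam.rowLen i : ℤ) - ((e i).toNat : ℤ)) - (i : ℤ) + (j : ℤ))).det = 0 := by
      by_contra hne
      -- Shortening the upper of two equal rows but not the lower makes the corresponding matrix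
      -- rows coincide.
      have hstep : ∀ i : ℕ, ∀ hi : i + 1 < h, e ⟨i, by omega⟩ = true →
          e ⟨i + 1, hi⟩ = false → lam.rowLen (i + 1) < lam.rowLen i := by
        intro i hi h1 h2
        refine lt_of_le_of_ne (lam.rowLen_anti i (i + 1) (Nat.le_succ i)) fun heq => hne ?_
        refine jacobiTrudi_eq_zero_of_rows (c := c)
          (F := fun i => (lam.rowLen i : ℤ) - ((e i).toNat : ℤ)) (i := ⟨i, by omega⟩)
          (j := ⟨i + 1, hi⟩) (by simp) ?_
        simp only [h1, h2, heq]
        simp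
        ring
      -- If an empty last row is shortened, all its indices are at most `-h + (h - 1) < 0`.
      have hlast : ∀ i : ℕ, ∀ hi : i < h, i + 1 = h → e ⟨i, hi⟩ = true →
          0 < lam.rowLen i := by
        intro i hi hih h1
        refine Nat.pos_of_ne_zero fun h2 => hne ?_
        refine Matrix.det_eq_zero_of_row_eq_zero ⟨i, hi⟩ fun j => hc _ ?_
        have := j.2
        simp only [h1, h2, Bool.toNat_true]
        omega
      -- Every shortened row is non-empty, so the truncated subtraction defining `κ` loses nothing.
      have hpos : ∀ k i : ℕ, ∀ hi : i < h, i + k + 1 = h → e ⟨i, hi⟩ = true →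
          0 < lam.rowLen i := by
        intro k
        induction k with
        | zero => exact hlast
        | succ k ih =>
          intro i hi hik h1
          cases h2 : e ⟨i + 1, by omega⟩
          · have := hstep i (by omega) h1 h2
            omega
          · have := ih (i + 1) (by omega) (by omega) h2
            exact this.trans_le (lam.rowLen_anti i (i + 1) (Nat.le_succ i))
      obtain ⟨κ, hκ, hrow⟩ := exists_rows (fun i : Fin h => lam.rowLen i - (e i).toNat) <| by
        intro i hi
        have h1 := lam.rowLen_anti i (i + 1) (Nat.le_succ i)
        have h3 := hstep i hi
        cases h4 : e ⟨i, by omega⟩ <;> cases h5 : e ⟨i + 1, hi⟩ <;> simp [h4, h5] at h3 ⊢ <;> omega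
      have hv : VStrip κ lam := vStrip_iff.2 fun i => by
        by_cases hi : i < h
        · have := hrow ⟨i, hi⟩
          have h2 := (e ⟨i, hi⟩).toNat_le
          simp only at this
          omega
        · rw [rowLen_eq_zero_iff.2 (show κ.colLen 0 ≤ i by omega),
            rowLen_eq_zero_iff.2 (show lam.colLen 0 ≤ i by omega)]
          omega
      refine he ⟨⟨κ, hv⟩, funext fun i => ?_⟩
      have h1 := hrow i
      have h2 := hpos (h - 1 - i) i i.2 (by omega)
      simp only [h1]
      cases h3 : e i
      · simp
      · simpa using h2 h3
    rw [hdet, mul_zero]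
  · intro κ
    have hrow : ∀ i : ℕ, ((decide (κ.1.rowLen i < lam.rowLen i)).toNat) =
        lam.rowLen i - κ.1.rowLen i := fun i => by
      have h1 := vStrip_iff.1 κ.2 i
      by_cases h2 : κ.1.rowLen i < lam.rowLen i
      · simp only [h2, decide_true, Bool.toNat_true]
        omega
      · simp only [h2, decide_false, Bool.toNat_false]
        omega
    rw [Finset.prod_pow_eq_pow_sum]
    congr 2
    · rw [card_eq_sum_rowLen hl, card_eq_sum_rowLen (hcol κ)]
      simp only [hrow]
      rw [Fin.sum_univ_eq_sum_range (fun i => lam.rowLen i - κ.1.rowLen i) h,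
        Finset.sum_tsub_distrib _ fun i _ => (vStrip_iff.1 κ.2 i).1]
    · refine congrArg Matrix.det (Matrix.ext fun i j => ?_)
      simp only [Matrix.of_apply, hrow, YoungDiagram.rows]
      have h1 := (vStrip_iff.1 κ.2 i).1
      congr 3
      omega

/-- The shapes with at most `h` rows and at most `N` columns. -/
abbrev ShapeBox (h N : ℕ) : Type :=
  {lam : YoungDiagram // lam.colLen 0 ≤ h ∧ lam.rowLen 0 ≤ N}

instance ShapeBox.instFinite (h N : ℕ) : Finite (ShapeBox h N) := by
  refine Finite.of_injective
    (fun lam : ShapeBox h N => fun i : Fin h => (⟨lam.1.rowLen i, Nat.lt_succ_of_le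
      ((lam.1.rowLen_anti 0 i (Nat.zero_le _)).trans lam.2.2)⟩ : Fin (N + 1))) ?_
  intro lam κ he
  refine Subtype.ext (ext_rows lam.2.1 κ.2.1 fun i => ?_)
  simpa using congrFun he i

noncomputable instance ShapeBox.instFintype (h N : ℕ) : Fintype (ShapeBox h N) :=
  Fintype.ofFinite _

open Classical in
/-- The expansion of a Jacobi–Trudi determinant on dividing the generating function of the
coefficients by `1 - 1 / z`. -/
theorem jacobiTrudi_sum {c c' : ℤ → R} {N : ℕ} (hc : ∀ a, c' a = c a + c' (a + 1))
    (hN : ∀ a : ℤ, (N : ℤ) < a → c' a = 0) {h : ℕ} (mu : ShapeBox h N) :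
    jacobiTrudi c' h (mu.1.rows h) =
      ∑ lam : ShapeBox h N, if HStrip mu.1 lam.1 then jacobiTrudi c h (lam.1.rows h) else 0 := by
  obtain ⟨mu, hmu, hmN⟩ := mu
  have htel : ∀ (s : ℤ) (a b : ℕ), a ≤ b + 1 →
      c' (a + s) = ∑ l ∈ Finset.Icc a b, c (l + s) + c' (b + 1 + s) := by
    intro s a b hab
    induction b with
    | zero =>
      have : a = 0 ∨ a = 1 := by omega
      rcases this with rfl | rfl
      · simp [hc s, add_comm]
      · simp
    | succ b ih =>
      rcases hab.eq_or_lt with rfl | hlt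
      · simp
      · rw [ih (by omega), Finset.sum_Icc_succ_top (by omega), hc (b + 1 + s)]
        push_cast
        rw [show (b : ℤ) + 1 + 1 + s = b + 1 + s + 1 by ring]
        ring
  set A : Fin h → Finset ℕ := fun i =>
    Finset.Icc (mu.rowLen i) (if (i : ℕ) = 0 then N else mu.rowLen (i - 1)) with hA
  -- Telescoping `c'` from `mu_{i+1}` to `mu_i` leaves exactly the preceding row of the matrix,
  -- which a row operation removes; row `0` telescopes to zero beyond `N`. The remaining ranges are
  -- the interlacing conditions of a horizontal strip, so no terms have to cancel.
  have hdet : jacobiTrudi c' h (mu.rows h) =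
      ∑ f ∈ Fintype.piFinset A, jacobiTrudi c h f := by
    have h1 := det_sum_rows A fun i l j => c ((l : ℤ) - (i : ℤ) + ((j : Fin h) : ℤ))
    refine Eq.trans ?_ h1
    cases h with
    | zero => simp [jacobiTrudi]
    | succ h =>
      refine Matrix.det_eq_of_forall_row_eq_smul_add_pred (fun _ => 1) (fun j => ?_)
        fun i j => ?_
      · have h2 := htel j (mu.rowLen 0) N (by omega)
        rw [hN ((N : ℤ) + 1 + (j : ℕ)) (by omega), add_zero] at h2
        simpa [YoungDiagram.rows, hA] using h2
      · have h2 := htel (j - (i + 1)) (mu.rowLen (i + 1)) (mu.rowLen i)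
          ((mu.rowLen_anti i (i + 1) (Nat.le_succ i)).trans (Nat.le_succ _))
        simp only [Matrix.of_apply, YoungDiagram.rows, hA, Fin.val_succ, Fin.val_castSucc,
          Nat.add_eq_zero_iff, one_ne_zero, and_false, if_false, Nat.add_sub_cancel, one_mul]
        push_cast
        convert h2 using 2
        · ring
        · refine Finset.sum_congr rfl fun l _ => ?_
          congr 1
          ring
        · congr 1
          ring
  rw [hdet, ← Finset.sum_filter]
  symm
  refine Finset.sum_bij (fun lam _ => lam.1.rows h) ?_ ?_ ?_ ?_
  · intro lam hlam
    have hs := hStrip_iff.1 (Finset.mem_filter.1 hlam).2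
    refine Fintype.mem_piFinset.2 fun i => Finset.mem_Icc.2 ⟨(hs i).1, ?_⟩
    by_cases hi : (i : ℕ) = 0
    · rw [if_pos hi, YoungDiagram.rows, hi]
      exact lam.2.2
    · rw [if_neg hi]
      have := (hs (i - 1)).2
      rwa [Nat.sub_add_cancel (Nat.pos_of_ne_zero hi)] at this
  · intro lam _ κ _ he
    exact Subtype.ext (ext_rows lam.2.1 κ.2.1 fun i => congrFun he i)
  · intro f hf
    have hf' : ∀ i : Fin h, mu.rowLen i ≤ f i ∧ f i ≤ if (i : ℕ) = 0 then N else mu.rowLen (i - 1) :=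
      fun i => Finset.mem_Icc.1 (Fintype.mem_piFinset.1 hf i)
    obtain ⟨lam, hl, hrow⟩ := exists_rows f fun i hi => by
      have h1 := (hf' ⟨i + 1, hi⟩).2
      have h2 := (hf' ⟨i, by omega⟩).1
      simp only [Nat.add_eq_zero_iff, one_ne_zero, and_false, if_false,
        Nat.add_sub_cancel] at h1
      exact h1.trans h2
    have hs : HStrip mu lam := hStrip_iff.2 fun i => by
      constructor
      · by_cases hi : i < h
        · rw [hrow ⟨i, hi⟩]
          exact (hf' ⟨i, hi⟩).1
        · rw [rowLen_eq_zero_iff.2 (show mu.colLen 0 ≤ i by omega)]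
          exact Nat.zero_le _
      · by_cases hi : i + 1 < h
        · rw [hrow ⟨i + 1, hi⟩]
          simpa using (hf' ⟨i + 1, hi⟩).2
        · rw [rowLen_eq_zero_iff.2 (show lam.colLen 0 ≤ i + 1 by omega)]
          exact Nat.zero_le _
    have hlN : lam.rowLen 0 ≤ N := by
      by_cases hi : 0 < h
      · rw [hrow ⟨0, hi⟩]
        simpa using (hf' ⟨0, hi⟩).2
      · rw [rowLen_eq_zero_iff.2 (show lam.colLen 0 ≤ 0 by omega)]
        exact Nat.zero_le _
    exact ⟨⟨lam, hl, hlN⟩, Finset.mem_filter.2 ⟨Finset.mem_univ _, hs⟩, funext hrow⟩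
  · intro lam _
    rfl

/-! ### Coefficients of the symbol and Gessel's identity -/

/-- The coefficients of `∏ k < n, (1 + r k z)`. -/
def elemCoeff (r : ℕ → R) : ℕ → ℤ → R
  | 0, a => if a = 0 then 1 else 0
  | n + 1, a => elemCoeff r n a + r n * elemCoeff r n (a - 1)

theorem elemCoeff_of_neg (r : ℕ → R) (n : ℕ) : ∀ a < 0, elemCoeff r n a = 0 := by
  induction n with
  | zero => exact fun a ha => if_neg ha.ne
  | succ n ih => exact fun a ha => by rw [elemCoeff, ih a ha, ih (a - 1) (by omega)]; simp

theorem elemCoeff_of_lt (r : ℕ → R) (n : ℕ) : ∀ a : ℤ, (n : ℤ) < a → elemCoeff r n a = 0 := by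
  induction n with
  | zero => exact fun a ha => if_neg (by simpa using ha.ne')
  | succ n ih =>
    intro a ha
    push_cast at ha
    rw [elemCoeff, ih a (by omega), ih (a - 1) (by omega)]
    simp

/-- The coefficients of `(1 - 1 / z) ^ (-m) * ∏ k < n, (1 + r k z)`, expanded in `|z| > 1`. -/
noncomputable def symbolCoeff (r : ℕ → R) (n : ℕ) : ℕ → ℤ → R
  | 0, a => elemCoeff r n a
  | m + 1, a => ∑ l ∈ Finset.Icc a n, symbolCoeff r n m l

theorem symbolCoeff_of_lt (r : ℕ → R) (n m : ℕ) (a : ℤ) (ha : (n : ℤ) < a) :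
    symbolCoeff r n m a = 0 := by
  cases m with
  | zero => exact elemCoeff_of_lt r n a ha
  | succ m => rw [symbolCoeff, Finset.Icc_eq_empty (by omega), Finset.sum_empty]

theorem symbolCoeff_succ (r : ℕ → R) (n m : ℕ) (a : ℤ) :
    symbolCoeff r n (m + 1) a = symbolCoeff r n m a + symbolCoeff r n (m + 1) (a + 1) := by
  by_cases ha : (n : ℤ) < a
  · rw [symbolCoeff_of_lt _ _ _ _ ha, symbolCoeff_of_lt _ _ _ _ ha,
      symbolCoeff_of_lt _ _ _ (a + 1) (by omega), add_zero]
  · have h1 : Finset.Icc a (n : ℤ) = insert a (Finset.Icc (a + 1) (n : ℤ)) := by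
      ext b
      simp only [Finset.mem_Icc, Finset.mem_insert]
      omega
    rw [symbolCoeff, h1, Finset.sum_insert (by simp)]
    rfl

theorem card_transpose (κ : YoungDiagram) : κ.transpose.cells.card = κ.cells.card := by
  simp [YoungDiagram.transpose]

/-- The dual Jacobi–Trudi identity. -/
theorem jacobiTrudi_elemCoeff (r : ℕ → R) (n : ℕ) {h : ℕ} {lam : YoungDiagram}
    (hl : lam.colLen 0 ≤ h) :
    jacobiTrudi (elemCoeff r n) h (lam.rows h) = schurSum lam.transpose n r := by
  induction n generalizing lam with
  | zero =>
    by_cases hb : lam = ⊥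
    · subst hb
      rw [(show (⊥ : YoungDiagram).transpose = ⊥ from rfl), schurSum_bot,
        ← Matrix.det_one (n := Fin h)]
      refine congrArg Matrix.det ?_
      ext i j
      simp only [Matrix.of_apply, YoungDiagram.rows, rowLen_bot, elemCoeff, Matrix.one_apply]
      congr 1
      simp only [Fin.ext_iff, eq_iff_iff]
      omega
    · rw [schurSum_zero_of_ne_bot fun h => hb (transpose_eq_iff_eq_transpose.1 h)]
      have h0 : 0 < lam.colLen 0 := by
        refine Nat.pos_of_ne_zero fun h0 => hb ?_
        exact ext_rows h0.le (rowLen_eq_zero_iff.1 (rowLen_bot 0)) fun i => i.elim0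
      have h1 : lam.rowLen 0 ≠ 0 := fun h => by
        rw [rowLen_eq_zero_iff] at h
        omega
      refine Matrix.det_eq_zero_of_row_eq_zero ⟨0, by omega⟩ fun j => ?_
      simp only [Matrix.of_apply, YoungDiagram.rows, elemCoeff]
      exact if_neg (by push_cast; omega)
  | succ n ih =>
    rw [schurSum_succ]
    refine (jacobiTrudi_add_mul (elemCoeff_of_neg r n) (r n) hl).trans ?_
    refine Fintype.sum_equiv (transposeOrderIso.toEquiv.subtypeEquiv fun κ =>
      (hStrip_transpose (lam := κ) (κ := lam)).symm) _ _ fun κ => ?_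
    rw [ih ((colLen_le_of_le κ.2.1).trans hl)]
    change _ = r n ^ (lam.transpose.cells.card - κ.1.transpose.cells.card) *
      schurSum κ.1.transpose n r
    rw [card_transpose, card_transpose]

open Classical in
theorem ssytCount_box_succ {h N : ℕ} (lam : ShapeBox h N) (m : ℕ) :
    (ssytCount lam.1 (m + 1) : R) =
      ∑ mu : ShapeBox h N, if HStrip mu.1 lam.1 then (ssytCount mu.1 m : R) else 0 := by
  rw [← schurSum_one, schurSum_succ, ← Finset.sum_filter]
  simp only [one_pow, one_mul, schurSum_one]
  refine Finset.sum_bij (fun mu _ => ⟨mu.1, (colLen_le_of_le mu.2.1).trans lam.2.1,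
    (le_iff_rowLen.1 mu.2.1 0).trans lam.2.2⟩) ?_ ?_ ?_ ?_
  · exact fun mu _ => Finset.mem_filter.2 ⟨Finset.mem_univ _, mu.2⟩
  · exact fun mu _ nu _ he => Subtype.ext (congrArg (fun x : ShapeBox h N => x.1) he)
  · exact fun mu hmu => ⟨⟨mu.1, (Finset.mem_filter.1 hmu).2⟩, Finset.mem_univ _, rfl⟩
  · exact fun _ _ => rfl

/-- Removing the largest letter of the tableaux and exchanging sums trades one letter for one
division by `1 - 1/z`; with no letters left only the empty shape contributes. -/
theorem sum_ssytCount_mul_jacobiTrudi (r : ℕ → R) (n h m k : ℕ) :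
    ∑ lam : ShapeBox h n, (ssytCount lam.1 m : R) *
        jacobiTrudi (symbolCoeff r n k) h (lam.1.rows h) =
      jacobiTrudi (symbolCoeff r n (k + m)) h (fun _ => 0) := by
  classical
  induction m generalizing k with
  | zero =>
    have hb : ((⊥ : YoungDiagram).colLen 0 ≤ h) ∧ (⊥ : YoungDiagram).rowLen 0 ≤ n :=
      ⟨(rowLen_eq_zero_iff.1 (rowLen_bot 0)).trans (Nat.zero_le h),
        (rowLen_bot 0).le.trans (Nat.zero_le n)⟩
    rw [Finset.sum_eq_single (⟨⊥, hb⟩ : ShapeBox h n)]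
    · rw [← schurSum_one, schurSum_bot, one_mul]
      congr 1
      exact funext fun i => rowLen_bot i
    · intro lam _ hne
      rw [← schurSum_one, schurSum_zero_of_ne_bot fun he => hne (Subtype.ext he), zero_mul]
    · exact fun h => absurd (Finset.mem_univ _) h
  | succ m ih =>
    rw [← add_assoc, add_right_comm, ← ih (k + 1)]
    simp only [ssytCount_box_succ (R := R), Finset.sum_mul]
    rw [Finset.sum_comm]
    refine Finset.sum_congr rfl fun mu _ => ?_
    rw [jacobiTrudi_sum (symbolCoeff_succ r n k)
      (fun a ha => symbolCoeff_of_lt r n (k + 1) a ha) mu, Finset.mul_sum]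
    refine Finset.sum_congr rfl fun lam _ => ?_
    split_ifs
    · rfl
    · rw [zero_mul, mul_zero]

/-- Gessel's identity. -/
theorem sum_ssytCount_mul_schurSum (r : ℕ → R) (n h m : ℕ) :
    ∑ lam : ShapeBox h n, (ssytCount lam.1 m : R) * schurSum lam.1.transpose n r =
      (Matrix.of fun i j : Fin h => symbolCoeff r n m ((i : ℤ) - (j : ℤ))).det := by
  have h1 := sum_ssytCount_mul_jacobiTrudi r n h m 0
  rw [zero_add] at h1
  rw [← Matrix.det_transpose]
  refine Eq.trans (Finset.sum_congr rfl fun lam _ => ?_) (h1.trans ?_)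
  · rw [← jacobiTrudi_elemCoeff r n lam.2.1]
    rfl
  · refine congrArg Matrix.det ?_
    ext i j
    simp only [Matrix.of_apply, Matrix.transpose_apply]
    congr 1
    push_cast
    ring

/-- In the dual Jacobi–Trudi determinant the top row consists of elementary symmetric polynomials of
degree above `n`. -/
theorem schurSum_transpose_eq_zero (r : ℕ → R) {n : ℕ} {lam : YoungDiagram}
    (hn : n < lam.rowLen 0) : schurSum lam.transpose n r = 0 := by
  have h0 : 0 < lam.colLen 0 := by
    by_contra! h
    rw [rowLen_eq_zero_iff.2 h] at hn
    omega
  rw [← jacobiTrudi_elemCoeff r n (le_refl (lam.colLen 0))]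
  refine Matrix.det_eq_zero_of_row_eq_zero ⟨0, h0⟩ fun j => elemCoeff_of_lt r n _ ?_
  simp only [YoungDiagram.rows]
  omega

end JacobiTrudi

/-! ### Laurent coefficients of the symbol as contour integrals -/

section LaurentCoefficients

open Metric

theorem laurentCoeff_congr {f g : ℂ → ℂ} {R : ℝ} (hR : 0 ≤ R) (h : Set.EqOn f g (sphere 0 R))
    (a : ℤ) : laurentCoeff f R a = laurentCoeff g R a := by
  rw [laurentCoeff, laurentCoeff, circleIntegral.integral_congr hR fun z hz =>
    congrArg (· * z ^ (-a - 1)) (h hz)]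

theorem ne_zero_of_mem_sphere_zero {R : ℝ} (hR : 0 < R) {z : ℂ} (hz : z ∈ sphere (0 : ℂ) R) :
    z ≠ 0 := by
  rintro rfl
  rw [mem_sphere, dist_self] at hz
  exact hR.ne hz

theorem circleIntegrable_mul_zpow {f : ℂ → ℂ} {R : ℝ} (hR : 0 < R)
    (hf : ContinuousOn f (sphere 0 R)) (a : ℤ) :
    CircleIntegrable (fun z => f z * z ^ a) 0 R :=
  ContinuousOn.circleIntegrable hR.le (hf.mul (continuousOn_id.zpow₀ a fun _ hz =>
    Or.inl (ne_zero_of_mem_sphere_zero hR hz)))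

theorem laurentCoeff_add {f g : ℂ → ℂ} {R : ℝ} (hR : 0 < R) (hf : ContinuousOn f (sphere 0 R))
    (hg : ContinuousOn g (sphere 0 R)) (a : ℤ) :
    laurentCoeff (fun z => f z + g z) R a = laurentCoeff f R a + laurentCoeff g R a := by
  simp only [laurentCoeff, add_mul]
  rw [circleIntegral.integral_add (circleIntegrable_mul_zpow hR hf _)
    (circleIntegrable_mul_zpow hR hg _), mul_add]

theorem laurentCoeff_const_mul (c : ℂ) (f : ℂ → ℂ) (R : ℝ) (a : ℤ) :
    laurentCoeff (fun z => c * f z) R a = c * laurentCoeff f R a := by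
  simp only [laurentCoeff, mul_assoc, circleIntegral.integral_const_mul]
  ring

theorem laurentCoeff_mul_zpow (f : ℂ → ℂ) {R : ℝ} (hR : 0 < R) (k a : ℤ) :
    laurentCoeff (fun z => f z * z ^ k) R a = laurentCoeff f R (a - k) := by
  rw [laurentCoeff, laurentCoeff, circleIntegral.integral_congr hR.le fun z hz => ?_]
  rw [mul_assoc, ← zpow_add₀ (ne_zero_of_mem_sphere_zero hR hz)]
  congr 2
  ring

theorem laurentCoeff_one {R : ℝ} (hR : 0 < R) (a : ℤ) :
    laurentCoeff (fun _ => 1) R a = if a = 0 then 1 else 0 := by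
  have h2 : (2 * (Real.pi : ℂ) * Complex.I) ≠ 0 := Complex.two_pi_I_ne_zero
  simp only [laurentCoeff, one_mul]
  split_ifs with ha
  · have h1 := circleIntegral.integral_sub_center_inv 0 hR.ne'
    simp only [sub_zero] at h1
    simp only [ha, neg_zero, zero_sub, zpow_neg_one, h1]
    exact inv_mul_cancel₀ h2
  · have h1 := circleIntegral.integral_sub_zpow_of_ne (n := -a - 1) (by omega) 0 0 R
    simp only [sub_zero] at h1
    rw [h1, mul_zero]

theorem exists_norm_laurentCoeff_le {f : ℂ → ℂ} {R : ℝ} (hR : 0 < R)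
    (hf : ContinuousOn f (sphere 0 R)) :
    ∃ C : ℝ, ∀ a : ℤ, ‖laurentCoeff f R a‖ ≤ C * R ^ (-a) := by
  obtain ⟨M, hM⟩ := (isCompact_sphere (0 : ℂ) R).exists_bound_of_continuousOn hf
  refine ⟨M, fun a => ?_⟩
  have h1 := circleIntegral.norm_two_pi_i_inv_smul_integral_le_of_norm_le_const
    (f := fun z => f z * z ^ (-a - 1)) (c := 0) (C := M * R ^ (-a - 1)) hR.le fun z hz => by
      rw [norm_mul, norm_zpow, mem_sphere_zero_iff_norm.1 hz]
      exact mul_le_mul_of_nonneg_right (hM z hz) (zpow_nonneg hR.le _)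
  refine h1.trans_eq ?_
  rw [zpow_sub_one₀ hR.ne']
  field_simp

theorem one_sub_ne_zero_of_mem_sphere_zero {R : ℝ} (hR : 1 < R) {z : ℂ} (hz : z ∈ sphere (0 : ℂ) R) :
    1 - 1 / z ≠ 0 := by
  have hz0 := ne_zero_of_mem_sphere_zero (zero_lt_one.trans hR) hz
  intro h
  have h1 : z = 1 := by
    field_simp at h
    exact sub_eq_zero.1 (h.trans (mul_zero z))
  rw [mem_sphere_zero_iff_norm, h1, norm_one] at hz
  exact hR.ne hz

theorem continuousOn_odbSymbol (m : ℕ) {n : ℕ} (r : Fin n → ℝ) {R : ℝ} (hR : 1 < R) :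
    ContinuousOn (odbSymbol m r) (sphere 0 R) := by
  refine ContinuousOn.mul (ContinuousOn.zpow₀ ?_ _ fun z hz =>
    Or.inl (one_sub_ne_zero_of_mem_sphere_zero hR hz)) (by fun_prop)
  exact continuousOn_const.sub (continuousOn_const.div continuousOn_id fun z hz =>
    ne_zero_of_mem_sphere_zero (zero_lt_one.trans hR) hz)

theorem laurentCoeff_odbSymbol_zero (r : ℕ → ℝ) (n : ℕ) {R : ℝ} (hR : 1 < R) (a : ℤ) :
    laurentCoeff (odbSymbol 0 fun j : Fin n => r j) R a = ((elemCoeff r n a : ℝ) : ℂ) := by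
  have hR0 := zero_lt_one.trans hR
  induction n generalizing a with
  | zero =>
    rw [laurentCoeff_congr hR0.le (g := fun _ => 1) fun z _ => by simp [odbSymbol],
      laurentCoeff_one hR0, elemCoeff]
    split_ifs <;> simp
  | succ n ih =>
    have hc := continuousOn_odbSymbol 0 (fun j : Fin n => r j) hR
    rw [laurentCoeff_congr hR0.le (g := fun z => odbSymbol 0 (fun j : Fin n => r j) z +
      (r n : ℂ) * (odbSymbol 0 (fun j : Fin n => r j) z * z ^ (1 : ℤ))) fun z _ => by
        simp only [odbSymbol, Fin.prod_univ_castSucc, Fin.val_castSucc, Fin.val_last, zpow_one]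
        ring]
    rw [laurentCoeff_add hR0 hc (g := fun z => (r n : ℂ) *
        (odbSymbol 0 (fun j : Fin n => r j) z * z ^ (1 : ℤ))) (continuousOn_const.mul (hc.mul
      (continuousOn_id.zpow₀ 1 fun _ _ => Or.inr zero_le_one))), laurentCoeff_const_mul,
      laurentCoeff_mul_zpow _ hR0, ih, ih, elemCoeff]
    push_cast
    rfl

/-- On the circle `φ_{m+1} (1 - 1/z) = φ_m`, that is `φ_{m+1} = φ_m + z⁻¹ φ_{m+1}`. -/
theorem laurentCoeff_odbSymbol_succ {n : ℕ} (r : Fin n → ℝ) (m : ℕ) {R : ℝ} (hR : 1 < R)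
    (a : ℤ) : laurentCoeff (odbSymbol (m + 1) r) R a =
      laurentCoeff (odbSymbol m r) R a + laurentCoeff (odbSymbol (m + 1) r) R (a + 1) := by
  have hR0 := zero_lt_one.trans hR
  have hc := continuousOn_odbSymbol m r hR
  have hc' := continuousOn_odbSymbol (m + 1) r hR
  rw [laurentCoeff_congr hR0.le (g := fun z => odbSymbol m r z +
    odbSymbol (m + 1) r z * z ^ (-1 : ℤ)) fun z hz => ?_, laurentCoeff_add hR0 hc
      (g := fun z => odbSymbol (m + 1) r z * z ^ (-1 : ℤ)) (hc'.mul (continuousOn_id.zpow₀ _ fun _ hz => Or.inl (ne_zero_of_mem_sphere_zero hR0 hz))),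
    laurentCoeff_mul_zpow _ hR0, sub_neg_eq_add]
  have hz0 := ne_zero_of_mem_sphere_zero hR0 hz
  have h1 := one_sub_ne_zero_of_mem_sphere_zero hR hz
  have h2 : (1 - 1 / z) ^ (-(m : ℤ)) = (1 - 1 / z) ^ (-((m + 1 : ℕ) : ℤ)) * (1 - 1 / z) := by
    rw [← zpow_add_one₀ h1]
    congr 1
    push_cast
    ring
  simp only [odbSymbol, h2, zpow_neg_one]
  field_simp
  ring

theorem laurentCoeff_odbSymbol (r : ℕ → ℝ) (n m : ℕ) {R : ℝ} (hR : 1 < R) (a : ℤ) :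
    laurentCoeff (odbSymbol m fun j : Fin n => r j) R a = ((symbolCoeff r n m a : ℝ) : ℂ) := by
  have hR0 := zero_lt_one.trans hR
  induction m generalizing a with
  | zero => exact laurentCoeff_odbSymbol_zero r n hR a
  | succ m ih =>
    set L := laurentCoeff (odbSymbol (m + 1) fun j : Fin n => r j) R with hL
    have hrec : ∀ a, L a = ((symbolCoeff r n m a : ℝ) : ℂ) + L (a + 1) := fun a => by
      rw [hL, laurentCoeff_odbSymbol_succ _ m hR a, ih]
    -- Above degree `n` the recursion makes `L` constant, while `R > 1` forces decay like `R ^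
    -- (-a)`; this fixes the initial value, and the recursion then runs downwards.
    have hvanish : ∀ a : ℤ, (n : ℤ) < a → L a = 0 := by
      intro a ha
      have hconst : ∀ k : ℕ, L (a + k) = L a := by
        intro k
        induction k with
        | zero => simp
        | succ k hk =>
          rw [← hk, hrec (a + k), symbolCoeff_of_lt r n m _ (by omega), Complex.ofReal_zero,
            zero_add]
          push_cast
          rw [add_assoc]
      obtain ⟨C, hC⟩ := exists_norm_laurentCoeff_le hR0
        (continuousOn_odbSymbol (m + 1) (fun j : Fin n => r j) hR)
      have hlim : Filter.Tendsto (fun k : ℕ => C * R ^ (-a) * (R⁻¹) ^ k) Filter.atTop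
          (nhds (C * R ^ (-a) * 0)) :=
        (tendsto_pow_atTop_nhds_zero_of_lt_one (inv_nonneg.2 hR0.le)
          (inv_lt_one_of_one_lt₀ hR)).const_mul _
      rw [mul_zero] at hlim
      refine norm_le_zero_iff.1 (ge_of_tendsto' hlim fun k => ?_)
      have h1 := hC (a + k)
      rw [← hL, hconst] at h1
      refine h1.trans_eq ?_
      rw [neg_add, zpow_add₀ hR0.ne', zpow_neg R (k : ℤ), zpow_natCast, inv_pow, mul_assoc]
    have hind : ∀ k : ℕ, ∀ a : ℤ, (n : ℤ) < a + k → L a = ((symbolCoeff r n (m + 1) a : ℝ) : ℂ) := by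
      intro k
      induction k with
      | zero =>
        intro a ha
        rw [hvanish a (by simpa using ha), symbolCoeff_of_lt r n _ a (by simpa using ha),
          Complex.ofReal_zero]
      | succ k hk =>
        intro a ha
        rw [hrec, symbolCoeff_succ, hk (a + 1) (by push_cast at ha; omega), Complex.ofReal_add]
    exact hind (n - a + 1).toNat a (by omega)

theorem toeplitzDet_odbSymbol (r : ℕ → ℝ) (n m h : ℕ) {R : ℝ} (hR : 1 < R) :
    toeplitzDet (odbSymbol m fun j : Fin n => r j) R h =
      ((∑ lam : ShapeBox h n, (ssytCount lam.1 m : ℝ) * schurSum lam.1.transpose n r : ℝ) : ℂ) := by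
  rw [sum_ssytCount_mul_schurSum, toeplitzDet]
  simp only [laurentCoeff_odbSymbol r n m hR]
  refine Eq.trans ?_ (RingHom.map_det Complex.ofRealHom
    (Matrix.of fun i j : Fin h => symbolCoeff r n m ((i : ℤ) - (j : ℤ)))).symm
  rfl

end LaurentCoefficients

/-! ### From the process to its one-point law -/

section Heights

open YoungDiagram MeasureTheory ProbabilityTheory

/-- Heights are integers or `⊥`, so when the left neighbour is strictly higher a coin could not lift
the site above it; catching up and growing merge into one maximum. -/
theorem IsODBTrajectory.succ_eq {ξ : ℕ → ℕ → Bool} {η : ℕ → ℕ → WithBot ℕ}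
    (hη : IsODBTrajectory ξ η) (t x : ℕ) :
    η (t + 1) x = max (leftHeight (η t) x) (η t x + ((ξ x t).toNat : WithBot ℕ)) := by
  by_cases h : η t x < leftHeight (η t) x
  · rw [hη.catch_up t x h, max_eq_left]
    cases hl : leftHeight (η t) x with
    | bot => simp [hl] at h
    | coe l =>
      cases he : η t x with
      | bot => simp
      | coe e =>
        rw [hl, he, WithBot.coe_lt_coe] at h
        have h1 := (ξ x t).toNat_le
        have h2 : e + (ξ x t).toNat ≤ l := by omega
        exact WithBot.coe_le_coe.2 h2
  · have h1 : leftHeight (η t) x ≤ η t x + ((ξ x t).toNat : WithBot ℕ) :=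
      (not_lt.1 h).trans (le_add_of_nonneg_right (by exact_mod_cast Nat.zero_le _))
    rw [max_eq_right h1]
    cases hξ : ξ x t
    · rw [hη.rest t x h hξ]
      simp
    · rw [hη.grow t x h hξ]
      simp

theorem IsODBTrajectory.eq_bot {ξ : ℕ → ℕ → Bool} {η : ℕ → ℕ → WithBot ℕ}
    (hη : IsODBTrajectory ξ η) {t x : ℕ} (htx : t < x) : η t x = ⊥ := by
  induction t generalizing x with
  | zero => rw [hη.init, cornerHeight, if_neg htx.ne']
  | succ t ih =>
    obtain ⟨x, rfl⟩ : ∃ y, x = y + 1 := ⟨x - 1, by omega⟩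
    rw [hη.succ_eq, leftHeight, ih (by omega), ih (by omega)]
    simp

theorem IsODBTrajectory.eq_growthHeight {ξ : ℕ → ℕ → Bool} {η : ℕ → ℕ → WithBot ℕ}
    (hη : IsODBTrajectory ξ η) (x s : ℕ) :
    η (x + s) x = (growthHeight (fun k s => ξ k (k + s)) (x + 1) s : WithBot ℕ) := by
  induction x generalizing s with
  | zero =>
    induction s with
    | zero => exact hη.init 0
    | succ s ih =>
      rw [← add_assoc, hη.succ_eq, ih, leftHeight, max_eq_right bot_le]
      simp [growthHeight, nextHeight]
  | succ x ihx =>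
    induction s with
    | zero =>
      rw [add_zero, hη.succ_eq, leftHeight, hη.eq_bot (Nat.lt_succ_self x)]
      have h := ihx 0
      rw [add_zero] at h
      rw [h]
      rfl
    | succ s ih =>
      have hl : η (x + 1 + s) x = _ := (congrArg (η · x) (by ring)).trans (ihx (s + 1))
      rw [← add_assoc, hη.succ_eq, ih, leftHeight, hl]
      exact (WithBot.coe_max _ _).symm

variable {Ω : Type*} [MeasurableSpace Ω] {μ : Measure Ω}

/-- Distinct matrix positions use distinct coins, and a coin shows `b` with probability `q r ^ b`,
`b ∈ {0, 1}`. -/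
theorem measure_coins_eq [IsProbabilityMeasure μ] {p : ℕ → ℝ} (hp : ∀ x, 0 < p x ∧ p x < 1)
    {ξ : ℕ × ℕ → Ω → Bool} (hm : ∀ s, Measurable (ξ s)) (hind : iIndepFun ξ μ)
    (hξ : ∀ x t, μ.real {ω | ξ (x, t) ω = true} = p x) (n m : ℕ) (A : Fin n → Fin m → Bool) :
    μ {ω | (fun (k : Fin n) (i : Fin m) => ξ ((k : ℕ), (k + i : ℕ)) ω) = A} =
      (∏ k : Fin n, ENNReal.ofReal ((1 - p k) ^ m)) *
        ∏ k : Fin n, ∏ i : Fin m, ENNReal.ofReal (p k / (1 - p k)) ^ (A k i).toNat := by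
  have hg : Function.Injective
      (fun c : Fin n × Fin m => ((c.1 : ℕ), ((c.1 : ℕ) + (c.2 : ℕ)))) := by
    rintro ⟨k, i⟩ ⟨k', i'⟩ h
    simp only [Prod.mk.injEq] at h
    ext <;> simp <;> omega
  have h1 := (hind.precomp hg).measure_inter_preimage_eq_mul Finset.univ
    (sets := fun c => {A c.1 c.2}) fun _ _ => measurableSet_singleton _
  have h2 : {ω | (fun (k : Fin n) (i : Fin m) => ξ ((k : ℕ), (k + i : ℕ)) ω) = A} =
      ⋂ c ∈ (Finset.univ : Finset (Fin n × Fin m)),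
        (fun ω => ξ ((c.1 : ℕ), ((c.1 : ℕ) + (c.2 : ℕ))) ω) ⁻¹' {A c.1 c.2} := by
    ext ω
    simp [funext_iff]
  have h3 : ∀ (k t : ℕ) (b : Bool), μ (ξ (k, t) ⁻¹' {b}) =
      ENNReal.ofReal (1 - p k) * ENNReal.ofReal (p k / (1 - p k)) ^ b.toNat := by
    intro k t b
    have hq : 0 < 1 - p k := sub_pos.2 (hp k).2
    have ht : μ (ξ (k, t) ⁻¹' {true}) = ENNReal.ofReal (p k) := by
      rw [← hξ k t, ofReal_measureReal]
      rfl
    cases b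
    · have hc : ξ (k, t) ⁻¹' {false} = (ξ (k, t) ⁻¹' {true})ᶜ := by
        ext ω
        simp
      rw [hc, prob_compl_eq_one_sub (hm _ (measurableSet_singleton _)), ht,
        Bool.toNat_false, pow_zero, mul_one, ENNReal.ofReal_sub _ (hp k).1.le, ENNReal.ofReal_one]
    · rw [ht, Bool.toNat_true, pow_one, ← ENNReal.ofReal_mul hq.le, mul_div_cancel₀ _ hq.ne']
  rw [h2]
  refine h1.trans ?_
  rw [Fintype.prod_prod_type, ← Finset.prod_mul_distrib]
  refine Finset.prod_congr rfl fun k _ => ?_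
  have h4 : ENNReal.ofReal ((1 - p k) ^ m) = ∏ _i : Fin m, ENNReal.ofReal (1 - p k) := by
    rw [Finset.prod_const, Finset.card_univ, Fintype.card_fin,
      ENNReal.ofReal_pow (sub_nonneg.2 (hp k).2.le)]
  rw [h4, ← Finset.prod_mul_distrib]
  exact Finset.prod_congr rfl fun i _ => h3 _ _ _

theorem measure_preimage_eq_sum_indic {α : Type*} [Fintype α] {f : Ω → α}
    (hf : ∀ a, MeasurableSet {ω | f ω = a}) (P : α → Prop) :
    μ {ω | P (f ω)} = ∑ a, μ {ω | f ω = a} * indic (P a) := by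
  classical
  have h1 := sum_measure_preimage_singleton (μ := μ) (f := f) (Finset.univ.filter P)
    fun a _ => hf a
  have h2 : f ⁻¹' (Finset.univ.filter P : Finset α) = {ω | P (f ω)} := by
    ext ω
    simp
  rw [← h2, ← h1, Finset.sum_filter]
  refine Finset.sum_congr rfl fun a _ => ?_
  by_cases ha : P a
  · rw [if_pos ha, indic_pos ha, mul_one]
    rfl
  · rw [if_neg ha, indic_neg ha, mul_zero]

theorem schurSum_ofReal (κ : YoungDiagram) (n : ℕ) {r : ℕ → ℝ} (hr : ∀ k, 0 ≤ r k) :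
    schurSum κ n (fun k => ENNReal.ofReal (r k)) = ENNReal.ofReal (schurSum κ n r) := by
  rw [schurSum, schurSum, ENNReal.ofReal_sum_of_nonneg fun T _ => Finset.prod_nonneg fun c _ => hr _]
  exact Finset.sum_congr rfl fun T _ => (ENNReal.ofReal_prod_of_nonneg fun c _ => hr _).symm

theorem schurSum_nonneg (κ : YoungDiagram) (n : ℕ) {r : ℕ → ℝ} (hr : ∀ k, 0 ≤ r k) :
    0 ≤ schurSum κ n r :=
  Finset.sum_nonneg fun _ _ => Finset.prod_nonneg fun _ _ => hr _

/-- Passing to `λ = κ'` turns the bound on the first row into a bound on the number of rows; shapes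
wider than `n` have weight zero. -/
theorem tsum_schurSum_eq_box (n m h : ℕ) {r : ℕ → ℝ} (hr : ∀ k, 0 ≤ r k) :
    ∑' κ, (ssytCount κ.transpose m : ENNReal) *
        (schurSum κ n (fun k => ENNReal.ofReal (r k)) * indic (κ.rowLen 0 ≤ h)) =
      ENNReal.ofReal (∑ lam : ShapeBox h n,
        (ssytCount lam.1 m : ℝ) * schurSum lam.1.transpose n r) := by
  rw [← transposeOrderIso.toEquiv.tsum_eq, ENNReal.ofReal_sum_of_nonneg fun lam _ =>
    mul_nonneg (Nat.cast_nonneg _) (schurSum_nonneg _ n hr)]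
  rw [← tsum_indic_subtype (fun lam : YoungDiagram => lam.colLen 0 ≤ h ∧ lam.rowLen 0 ≤ n)
    (fun lam => ENNReal.ofReal ((ssytCount lam m : ℝ) * schurSum lam.transpose n r))]
  refine tsum_congr fun lam => ?_
  change (ssytCount lam.transpose.transpose m : ENNReal) *
    (schurSum lam.transpose n _ * indic (lam.transpose.rowLen 0 ≤ h)) = _
  rw [transpose_transpose, rowLen_transpose, schurSum_ofReal _ _ hr,
    ENNReal.ofReal_mul (Nat.cast_nonneg _), ENNReal.ofReal_natCast, indic_and]
  by_cases hn : lam.rowLen 0 ≤ n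
  · rw [indic_pos hn]
    ring
  · rw [schurSum_transpose_eq_zero r (not_le.1 hn), ENNReal.ofReal_zero]
    ring

theorem hasSum_ssytCount_mul_schurSum (n m h : ℕ) (r : ℕ → ℝ) :
    HasSum (fun lam : {lam : YoungDiagram // partitionLength lam ≤ h} =>
        (ssytCount lam.1 m : ℝ) * schurSum lam.1.transpose n r)
      (∑ lam : ShapeBox h n, (ssytCount lam.1 m : ℝ) * schurSum lam.1.transpose n r) := by
  have hlen : ∀ lam : YoungDiagram, partitionLength lam = lam.colLen 0 := fun lam =>
    length_rowLens
  have hinj : Function.Injective (fun lam : ShapeBox h n =>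
      (⟨lam.1, (hlen lam.1).le.trans lam.2.1⟩ :
        {lam : YoungDiagram // partitionLength lam ≤ h})) :=
    fun a b he => Subtype.ext (congrArg (fun x => x.1) he)
  refine (hinj.hasSum_iff ?_).1 (hasSum_fintype _)
  intro lam hlam
  have hn : n < lam.1.rowLen 0 := by
    by_contra! hn
    exact hlam ⟨⟨lam.1, (hlen lam.1).ge.trans lam.2, hn⟩, rfl⟩
  rw [schurSum_transpose_eq_zero r hn, mul_zero]

theorem measureReal_height_le [IsProbabilityMeasure μ] {p : ℕ → ℝ}
    (hp : ∀ x, 0 < p x ∧ p x < 1) {H : ℕ → ℕ → Ω → WithBot ℕ} (hH : IsInhomogeneousODB p μ H)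
    (x m h : ℕ) :
    μ.real {ω | H (x + m) x ω ≤ (h : WithBot ℕ)} =
      (∏ j : Fin (x + 1), (1 - p j) ^ m) * ∑ lam : ShapeBox h (x + 1),
        (ssytCount lam.1 m : ℝ) * schurSum lam.1.transpose (x + 1) fun j => p j / (1 - p j) := by
  obtain ⟨ξ, hm, hind, hξ, htraj⟩ := hH
  have hr : ∀ k, 0 ≤ p k / (1 - p k) := fun k =>
    div_nonneg (hp k).1.le (sub_nonneg.2 (hp k).2.le)
  set coins : Ω → Fin (x + 1) → Fin m → Bool := fun ω k i => ξ ((k : ℕ), (k + i : ℕ)) ω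
    with hcoins
  -- Almost sure equality with an event of finitely many coins replaces measurability of `H`.
  have hevent : μ {ω | H (x + m) x ω ≤ (h : WithBot ℕ)} =
      μ {ω | (ShapeChain.growth m (x + 1) (coins ω)).last.rowLen 0 ≤ h} := by
    refine measure_congr (Filter.eventuallyEq_set.2 ?_)
    filter_upwards [htraj] with ω hω
    have h1 := hω.eq_growthHeight x m
    have h2 := (ShapeChain.hasFirstRows_growth (fun k s => ξ (k, k + s) ω) m (x + 1)).1.last
    change H (x + m) x ω ≤ (h : WithBot ℕ) ↔ (ShapeChain.growth m (x + 1) (coins ω)).last.rowLen 0 ≤ h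
    rw [h1, ← h2]
    exact WithBot.coe_le_coe
  have hmeas : ∀ A, MeasurableSet {ω | coins ω = A} := fun A => by
    have : Measurable coins :=
      measurable_pi_lambda _ fun k => measurable_pi_lambda _ fun i => hm _
    exact this (measurableSet_singleton A)
  rw [measureReal_def, hevent, measure_preimage_eq_sum_indic hmeas
    fun A => (ShapeChain.growth m (x + 1) A).last.rowLen 0 ≤ h]
  simp only [hcoins, measure_coins_eq hp hm hind hξ, mul_assoc]
  rw [← Finset.mul_sum, sum_growth_last (fun k => ENNReal.ofReal (p k / (1 - p k))) m (x + 1)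
    fun κ => indic (κ.rowLen 0 ≤ h), tsum_schurSum_eq_box (x + 1) m h hr, ENNReal.toReal_mul,
    ENNReal.toReal_prod, ENNReal.toReal_ofReal (Finset.sum_nonneg fun lam _ =>
      mul_nonneg (Nat.cast_nonneg _) (schurSum_nonneg _ _ hr))]
  congr 1
  exact Finset.prod_congr rfl fun k _ =>
    ENNReal.toReal_ofReal (pow_nonneg (sub_nonneg.2 (hp k).2.le) m)

theorem measureReal_height_le_toeplitzDet [IsProbabilityMeasure μ] {p : ℕ → ℝ}
    (hp : ∀ x, 0 < p x ∧ p x < 1) {H : ℕ → ℕ → Ω → WithBot ℕ} (hH : IsInhomogeneousODB p μ H)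
    (x m h : ℕ) {R : ℝ} (hR : 1 < R) :
    ((μ.real {ω | H (x + m) x ω ≤ (h : WithBot ℕ)} : ℝ) : ℂ) =
      ((∏ j : Fin (x + 1), (1 - p j) ^ m : ℝ) : ℂ) *
        toeplitzDet (odbSymbol m (fun j : Fin (x + 1) => p j / (1 - p j))) R h := by
  rw [measureReal_height_le hp hH, Complex.ofReal_mul,
    toeplitzDet_odbSymbol (fun j => p j / (1 - p j)) (x + 1) m h hR]

end Heights

theorem mainTheorem9 (p : ℕ → ℝ) (hp : ∀ x, 0 < p x ∧ p x < 1)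
    {Ω : Type*} [MeasurableSpace Ω] (μ : MeasureTheory.Measure Ω)
    [MeasureTheory.IsProbabilityMeasure μ] (H : ℕ → ℕ → Ω → WithBot ℕ)
    (hH : IsInhomogeneousODB p μ H) (x t : ℕ) (hxt : x ≤ t) (h : ℕ) :
    -- the Schur measure formula
    (Summable (fun lam : {lam : YoungDiagram // partitionLength lam ≤ h} =>
        (ssytCount lam.1 (t - x) : ℝ) *
          schurValue lam.1.transpose (fun j : Fin (x + 1) => p j / (1 - p j))) ∧
      μ.real {ω | H t x ω ≤ (h : WithBot ℕ)} =
        (∏ j : Fin (x + 1), (1 - p j) ^ (t - x)) *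
          ∑' lam : {lam : YoungDiagram // partitionLength lam ≤ h},
            (ssytCount lam.1 (t - x) : ℝ) *
              schurValue lam.1.transpose (fun j : Fin (x + 1) => p j / (1 - p j))) ∧
    -- the Toeplitz determinant formula
    (∀ R : ℝ, 1 < R →
      ((μ.real {ω | H t x ω ≤ (h : WithBot ℕ)} : ℝ) : ℂ) =
        ((∏ j : Fin (x + 1), (1 - p j) ^ (t - x) : ℝ) : ℂ) *
          toeplitzDet (odbSymbol (t - x) (fun j : Fin (x + 1) => p j / (1 - p j))) R h) ∧
    -- the probability depends only on `p 0, …, p x`, and symmetrically so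
    (∀ (σ : Equiv.Perm (Fin (x + 1))) (p' : ℕ → ℝ), (∀ y, 0 < p' y ∧ p' y < 1) →
      (∀ j : Fin (x + 1), p' j = p (σ j)) →
      ∀ {Ω' : Type*} [MeasurableSpace Ω'] (μ' : MeasureTheory.Measure Ω')
        [MeasureTheory.IsProbabilityMeasure μ'] (H' : ℕ → ℕ → Ω' → WithBot ℕ),
        IsInhomogeneousODB p' μ' H' →
        μ'.real {ω | H' t x ω ≤ (h : WithBot ℕ)} =
          μ.real {ω | H t x ω ≤ (h : WithBot ℕ)}) := by
  obtain ⟨m, rfl⟩ := Nat.exists_eq_add_of_le hxt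
  rw [Nat.add_sub_cancel_left]
  have hsum := hasSum_ssytCount_mul_schurSum (x + 1) m h fun j => p j / (1 - p j)
  simp only [← schurSum_fin] at hsum
  refine ⟨⟨hsum.summable, ?_⟩, fun R hR => measureReal_height_le_toeplitzDet hp hH x m h hR, ?_⟩
  · rw [hsum.tsum_eq, measureReal_height_le hp hH]
    simp only [← schurSum_fin]
  · intro σ p' hp' hσ Ω' _ μ' _ H' hH'
    have hsymb : odbSymbol m (fun j : Fin (x + 1) => p' j / (1 - p' j)) =
        odbSymbol m (fun j : Fin (x + 1) => p j / (1 - p j)) := by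
      funext z
      simp only [odbSymbol, hσ]
      rw [Equiv.prod_comp σ fun j : Fin (x + 1) => 1 + ((p j / (1 - p j) : ℝ) : ℂ) * z]
    have hprod : ∏ j : Fin (x + 1), (1 - p' j) ^ m = ∏ j : Fin (x + 1), (1 - p j) ^ m := by
      simp only [hσ]
      exact Equiv.prod_comp σ fun j : Fin (x + 1) => (1 - p j) ^ m
    -- The symbol and the prefactor are products over `j`, hence invariant under `σ`; the radius `2`
    -- is an arbitrary choice above `1`.
    apply Complex.ofReal_injective
    rw [measureReal_height_le_toeplitzDet hp' hH' x m h one_lt_two,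
      measureReal_height_le_toeplitzDet hp hH x m h one_lt_two, hsymb, hprod]
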